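/- **Theorem (multi-matrix rectangular Cayley identity).** Fix integers $\ell\ge 1$ and $n_1,\dots,n_\ell\ge 0$ and write $n_{\ell+1}=n_1$. For $1\le\alpha\le\ell$ let $X^{(\alpha)}=(x^{(\alpha)}_{ij})$ be an $n_\alpha\times n_{\alpha+1}$ matrix of indeterminates and let $\partial^{(\alpha)}=(\partial/\partial x^{(\alpha)}_{ij})$ be the corresponding matrix of partial derivatives. Write $X=X^{(1)}\cdots X^{(\ell)}$ and $\partial=\partial^{(1)}\cdots\partial^{(\ell)}$, which are $n_1\times n_1$ matrices. Then $$\det(\partial)\,(\det X)^s=\Bigl(\prod_{\alpha=1}^{\ell}\prod_{j=0}^{n_1-1}(s+n_\alpha-n_1+j)\Bigr)(\det X)^{s-1}.$$ More generally, if $I,J\subseteq\{1,\dots,n_1\}$ with $|I|=|J|=k$, then $$\det(\partial_{IJ})\,(\det X)^s=\Bigl(\prod_{\alpha=1}^{\ell}\prod_{j=0}^{k-1}(s+n_\alpha-n_1+j)\Bigr)(\det X)^{s-1}\,\epsilon(I,J)\,\det(X_{I^cJ^c}).$$ Here $A_{IJ}$ is the submatrix of $A$ with rows $I$ and columns $J$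 in their original order, $I^c$ is the complement of $I$ in $\{1,\dots,n_1\}$, $\epsilon(I,J)=(-1)^{\sum_{i\in I}i+\sum_{j\in J}j}$, and the determinant of an empty matrix is $1$. Writing $x$ for the family of all the indeterminates $x^{(\alpha)}_{ij}$ and $P=\det X$, these identities hold in each of the following senses: 1. for every integer $s\ge1$, in the polynomial ring $R[x]$ over any commutative ring $R$; 2. for every integer $s$, in the field $K(x)$ of rational fractions over any field $K$, provided $P\ne0$; 3. for symbolic $s$, provided $P\neq 0$: for any field $K$ of characteristic $0$, in the free module $K[x,s,P^{-1}]\,P^s$ of rank one over $K[x,s,P^{-1}]$ with basis the formal symbol $P^s$, where $\frac{\partial}{\partial x_v}(fP^s)=\bigl(\frac{\partial f}{\partial x_v}+s f\frac{\partial P}{\partial x_v}P^{-1}\bigr)P^s$ for each indeterminate $x_v$, and $P^{s-1}=P^{-1}P^s$; 4. for every complex number $s$, as an identity between complex-valued functions of real variables, and likewise of complex variables, on any open set $U$ (of the real, respectively complex, space of values of $x$) on which $P$ has no zero and for any branch of $P^s$ on $U$, that is, any continuous function $\varphi$ on $U$ each of whose values $\varphi(x)$ has the form $e^{sw}$ with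 $e^w=P(x)$; the corresponding branch of $P^{s-1}$ is $\varphi/P$. -/

import Mathlib

open scoped BigOperators

noncomputable section

/-! ### Indeterminates, chains of rectangular matrices, minors and signs

The dimensions are `n 0, n 1, …, n ℓ`, with `n ℓ = n 0`; the matrices are numbered `0, …, ℓ - 1`,
and matrix number `α` has size `n α × n (α + 1)`. -/

/-- The index set of the variables `x^(α)_{ij}`. -/
abbrev ChainVar (ℓ : ℕ) (n : ℕ → ℕ) : Type :=
  Σ α : Fin ℓ, Fin (n α) × Fin (n (α + 1))

/-- The product of a chain of matrices of sizes `n 0 × n 1, n 1 × n 2, …`, in increasing order. -/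
def chainProd {A : Type*} [Semiring A] (n : ℕ → ℕ) :
    (ℓ : ℕ) → (∀ α : Fin ℓ, Matrix (Fin (n α)) (Fin (n (α + 1))) A) →
      Matrix (Fin (n 0)) (Fin (n ℓ)) A
  | 0, _ => 1
  | ℓ + 1, Y => chainProd n ℓ (fun α => Y α.castSucc) *
      Matrix.of fun (i : Fin (n ℓ)) (j : Fin (n (ℓ + 1))) => Y (Fin.last ℓ) i j

/-- The square matrix `X^(1) ⋯ X^(ℓ)` with `X^(α) = (x^(α)_{ij})`. -/
def XProd {A : Type*} [Semiring A] {ℓ : ℕ} {n : ℕ → ℕ} (hn : n ℓ = n 0) (x : ChainVar ℓ n → A) :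
    Matrix (Fin (n 0)) (Fin (n 0)) A :=
  (chainProd n ℓ (fun α => Matrix.of fun i j => x ⟨α, i, j⟩)).submatrix id (Fin.cast hn.symm)

/-- The submatrix with rows `I` and columns `J`, where `|I| = |J|`, in their original order. -/
def subMat {A : Type*} {N : ℕ} (Y : Matrix (Fin N) (Fin N) A) (I J : Finset (Fin N))
    (h : I.card = J.card) : Matrix (Fin I.card) (Fin I.card) A :=
  Y.submatrix (I.orderEmbOfFin rfl) (J.orderEmbOfFin h.symm)

theorem card_compl_eq_of_card_eq {N : ℕ} {I J : Finset (Fin N)} (h : I.card = J.card) :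
    Iᶜ.card = Jᶜ.card := by
  rw [Finset.card_compl, Finset.card_compl, h]

/-- `ε(I) = (-1)^{|I|(|I|-1)/2} (-1)^{∑_{i ∈ I} i}`, elements being numbered from `1`. -/
def eps {N : ℕ} (I : Finset (Fin N)) : ℤ :=
  (-1) ^ (I.card * (I.card - 1) / 2) * (-1) ^ (∑ i ∈ I, ((i : ℕ) + 1))

/-- `ε(I,J) = ε(I) ε(J)`. -/
def eps₂ {N : ℕ} (I J : Finset (Fin N)) : ℤ := eps I * eps J

/-- `∏_α ∏_{j=0}^{k-1} (s + n α - n 0 + j)`, with `α` running over all `ℓ` matrices. -/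
def bCoeff {A : Type*} [CommRing A] (ℓ : ℕ) (n : ℕ → ℕ) (k : ℕ) (s : A) : A :=
  ∏ α : Fin ℓ, ∏ j ∈ Finset.range k, (s + (n α : A) - (n 0 : A) + (j : A))

/-! ### Matrices of operators

Entries are operators on an additive group `V`; sums of operators are pointwise and products are
compositions. In every use below the entries of the matrices commute with each other, so the order
of the factors in the determinant plays no role. -/

/-- Product of matrices of operators. -/
def opMul {V : Type*} [AddCommGroup V] {a b c : Type*} [Fintype b]
    (P : Matrix a b (V → V)) (Q : Matrix b c (V → V)) : Matrix a c (V → V) :=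
  Matrix.of fun i k f => ∑ j, P i j (Q j k f)

/-- The identity matrix of operators. -/
def opOne (V : Type*) [AddCommGroup V] (N : ℕ) : Matrix (Fin N) (Fin N) (V → V) :=
  Matrix.of fun i j f => if i = j then f else 0

/-- Determinant of a matrix of (commuting) operators, by the Leibniz formula. -/
def opDet {V : Type*} [AddCommGroup V] {k : ℕ} (P : Matrix (Fin k) (Fin k) (V → V)) : V → V :=
  fun f => ∑ σ : Equiv.Perm (Fin k), (Equiv.Perm.sign σ : ℤ) •
    (List.ofFn fun i => P i (σ i)).foldr (fun D g => D g) f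

/-- The product of a chain of matrices of operators. -/
def opChainProd {V : Type*} [AddCommGroup V] (n : ℕ → ℕ) :
    (ℓ : ℕ) → (∀ α : Fin ℓ, Matrix (Fin (n α)) (Fin (n (α + 1))) (V → V)) →
      Matrix (Fin (n 0)) (Fin (n ℓ)) (V → V)
  | 0, _ => opOne V (n 0)
  | ℓ + 1, D => opMul (opChainProd n ℓ (fun α => D α.castSucc)) (D (Fin.last ℓ))

/-- The square matrix `∂^(1) ⋯ ∂^(ℓ)`, where `d v` is the operator `∂/∂v` for each variable `v`. -/
def DProd {V : Type*} [AddCommGroup V] {ℓ : ℕ} {n : ℕ → ℕ} (hn : n ℓ = n 0)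
    (d : ChainVar ℓ n → V → V) : Matrix (Fin (n 0)) (Fin (n 0)) (V → V) :=
  (opChainProd n ℓ (fun α => Matrix.of fun i j => d ⟨α, i, j⟩)).submatrix id (Fin.cast hn.symm)

/-! ### Derivations of localizations -/

/-- The ring homomorphism `b ↦ b + d(b) ε` into the dual numbers of the localization, for the
derivation `d` of `A` (extended to the localization `B`). -/
def locDualHom {R A B : Type*} [CommRing R] [CommRing A] [Algebra R A] [CommRing B] [Algebra A B]
    (M : Submonoid A) [IsLocalization M B] (d : Derivation R A A) : B →+* TrivSqZeroExt B B :=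
  IsLocalization.lift (M := M)
    (g := ({ toFun := fun a => TrivSqZeroExt.inl (algebraMap A B a)
                        + TrivSqZeroExt.inr (algebraMap A B (d a))
             map_one' := by ext <;> simp
             map_zero' := by ext <;> simp
             map_add' := fun a b => by
               rw [map_add, map_add, map_add, TrivSqZeroExt.inl_add, TrivSqZeroExt.inr_add]
               abel
             map_mul' := fun a b => by
               ext
               · simp
               · simp only [Derivation.leibniz, map_mul, map_add,
                   TrivSqZeroExt.snd_add, TrivSqZeroExt.snd_mul, TrivSqZeroExt.fst_add,
                   TrivSqZeroExt.snd_inl, TrivSqZeroExt.snd_inr, TrivSqZeroExt.fst_inl,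
                   TrivSqZeroExt.fst_inr, op_smul_eq_smul, smul_eq_mul]
                 ring } : A →+* TrivSqZeroExt B B))
    (fun y => by
      rw [TrivSqZeroExt.isUnit_iff_isUnit_fst]
      simpa using IsLocalization.map_units B y)

theorem locDualHom_algebraMap {R A B : Type*} [CommRing R] [CommRing A] [Algebra R A] [CommRing B]
    [Algebra A B] (M : Submonoid A) [IsLocalization M B] (d : Derivation R A A) (a : A) :
    locDualHom M d (algebraMap A B a) =
      TrivSqZeroExt.inl (algebraMap A B a) + TrivSqZeroExt.inr (algebraMap A B (d a)) := by
  simp [locDualHom]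

theorem fst_locDualHom {R A B : Type*} [CommRing R] [CommRing A] [Algebra R A] [CommRing B]
    [Algebra A B] (M : Submonoid A) [IsLocalization M B] (d : Derivation R A A) (b : B) :
    (locDualHom M d b).fst = b := by
  have h : ((TrivSqZeroExt.fstHom B B B).toRingHom.comp (locDualHom M d)) = RingHom.id B := by
    apply IsLocalization.ringHom_ext M
    ext a
    simp [locDualHom_algebraMap]
  exact congrArg (fun g : B →+* B => g b) h

/-- The unique extension of a derivation `d` of `A` to the localization `B = M⁻¹ A`. -/
def locDeriv {R A B : Type*} [CommRing R] [CommRing A] [Algebra R A] [CommRing B] [Algebra A B]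
    [Algebra R B] [IsScalarTower R A B] (M : Submonoid A) [IsLocalization M B]
    (d : Derivation R A A) : Derivation R B B :=
  Derivation.mk'
    { toFun := fun b => (locDualHom M d b).snd
      map_add' := fun a b => by simp
      map_smul' := fun r b => by
        rw [Algebra.smul_def, map_mul, IsScalarTower.algebraMap_apply R A B,
          locDualHom_algebraMap, TrivSqZeroExt.snd_mul]
        simp [Algebra.smul_def, IsScalarTower.algebraMap_apply R A B] }
    (fun a b => by simp [TrivSqZeroExt.snd_mul, fst_locDualHom, mul_comm])

theorem locDeriv_algebraMap {R A B : Type*} [CommRing R] [CommRing A] [Algebra R A] [CommRing B]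
    [Algebra A B] [Algebra R B] [IsScalarTower R A B] (M : Submonoid A) [IsLocalization M B]
    (d : Derivation R A A) (a : A) :
    locDeriv M d (algebraMap A B a) = algebraMap A B (d a) := by
  change (locDualHom M d (algebraMap A B a)).snd = _
  rw [locDualHom_algebraMap, TrivSqZeroExt.snd_add, TrivSqZeroExt.snd_inl, TrivSqZeroExt.snd_inr,
    zero_add]

/-! ### The settings in which `∂/∂x_v` acts and `det(X)^s` makes sense -/

/-- `X^(1) ⋯ X^(ℓ)` with entries in the polynomial ring `R[x]`. -/
def polyX (R : Type*) [CommRing R] {ℓ : ℕ} {n : ℕ → ℕ} (hn : n ℓ = n 0) :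
    Matrix (Fin (n 0)) (Fin (n 0)) (MvPolynomial (ChainVar ℓ n) R) :=
  XProd hn MvPolynomial.X

/-- `∂/∂x_v` on polynomials. -/
def polyD (R : Type*) [CommRing R] {σ : Type*} (v : σ) : MvPolynomial σ R → MvPolynomial σ R :=
  fun f => MvPolynomial.pderiv v f

/-- `X^(1) ⋯ X^(ℓ)` with entries in the field of rational fractions `K(x)`. -/
def ratX (K : Type*) [Field K] {ℓ : ℕ} {n : ℕ → ℕ} (hn : n ℓ = n 0) :
    Matrix (Fin (n 0)) (Fin (n 0)) (FractionRing (MvPolynomial (ChainVar ℓ n) K)) :=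
  XProd hn fun v => algebraMap (MvPolynomial (ChainVar ℓ n) K) _ (MvPolynomial.X v)

/-- `∂/∂x_v` on the field of rational fractions `K(x)`. -/
def ratD (K : Type*) [Field K] {σ : Type*} (v : σ) :
    FractionRing (MvPolynomial σ K) → FractionRing (MvPolynomial σ K) :=
  fun f => locDeriv (R := K) (nonZeroDivisors (MvPolynomial σ K)) (MvPolynomial.pderiv v) f

/-- The ring `K[x, s, P⁻¹]`: the localization at `P` of the polynomials in `x` over `K[s]`. -/
abbrev SymRing (K : Type*) [Field K] {σ : Type*} (P : MvPolynomial σ (Polynomial K)) : Type _ :=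
  Localization.Away P

/-- The indeterminate `s` as an element of `K[x, s, P⁻¹]`. -/
def symS (K : Type*) [Field K] {σ : Type*} (P : MvPolynomial σ (Polynomial K)) : SymRing K P :=
  algebraMap (MvPolynomial σ (Polynomial K)) (SymRing K P) (MvPolynomial.C Polynomial.X)

/-- `P⁻¹` as an element of `K[x, s, P⁻¹]`. -/
def symInv (K : Type*) [Field K] {σ : Type*} (P : MvPolynomial σ (Polynomial K)) : SymRing K P :=
  IsLocalization.Away.invSelf P

/-- The free module `K[x, s, P⁻¹] P^s` of rank one over `K[x, s, P⁻¹]`: the vector `⟨f⟩` is the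
formal expression `f P^s`. -/
@[ext]
structure SymPow (K : Type*) [Field K] {σ : Type*} (P : MvPolynomial σ (Polynomial K)) where
  coef : SymRing K P

/-- The identification of `K[x, s, P⁻¹] P^s` with the coefficient ring. -/
def SymPow.equiv (K : Type*) [Field K] {σ : Type*} (P : MvPolynomial σ (Polynomial K)) :
    SymPow K P ≃ SymRing K P where
  toFun f := f.coef
  invFun f := ⟨f⟩
  left_inv _ := rfl
  right_inv _ := rfl

instance (K : Type*) [Field K] {σ : Type*} (P : MvPolynomial σ (Polynomial K)) :
    AddCommGroup (SymPow K P) := (SymPow.equiv K P).addCommGroup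

instance (K : Type*) [Field K] {σ : Type*} (P : MvPolynomial σ (Polynomial K)) :
    Module (SymRing K P) (SymPow K P) := (SymPow.equiv K P).module (SymRing K P)

/-- The vector `P^s` of `K[x, s, P⁻¹] P^s`. -/
def symPow (K : Type*) [Field K] {σ : Type*} (P : MvPolynomial σ (Polynomial K)) : SymPow K P :=
  ⟨1⟩

/-- `∂/∂x_v (f P^s) = (∂f/∂x_v + s f (∂P/∂x_v) P⁻¹) P^s`. -/
def symD (K : Type*) [Field K] {σ : Type*} (P : MvPolynomial σ (Polynomial K)) (v : σ) :
    SymPow K P → SymPow K P :=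
  fun f => ⟨locDeriv (R := Polynomial K) (Submonoid.powers P) (MvPolynomial.pderiv v) f.coef
    + symS K P * f.coef * algebraMap _ (SymRing K P) (MvPolynomial.pderiv v P) * symInv K P⟩

/-- `∂/∂x_v` on complex-valued functions of real or complex variables. -/
def funD (𝕜 : Type*) [NontriviallyNormedField 𝕜] [NormedSpace 𝕜 ℂ] {σ : Type*} [DecidableEq σ]
    (v : σ) : ((σ → 𝕜) → ℂ) → ((σ → 𝕜) → ℂ) :=
  fun f x => lineDeriv 𝕜 f x (Pi.single v 1)

/-- `det(X^(1) ⋯ X^(ℓ))` as a polynomial in `x` over `K[s]`. -/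
def symP (K : Type*) [Field K] {ℓ : ℕ} {n : ℕ → ℕ} (hn : n ℓ = n 0) :
    MvPolynomial (ChainVar ℓ n) (Polynomial K) :=
  (polyX (Polynomial K) hn).det

/-- `X^(1) ⋯ X^(ℓ)` with entries in `K[x, s, P⁻¹]`, where `P = det(X^(1) ⋯ X^(ℓ))`. -/
def symX (K : Type*) [Field K] {ℓ : ℕ} {n : ℕ → ℕ} (hn : n ℓ = n 0) :
    Matrix (Fin (n 0)) (Fin (n 0)) (SymRing K (symP K hn)) :=
  XProd hn fun v =>
    algebraMap (MvPolynomial (ChainVar ℓ n) (Polynomial K)) _ (MvPolynomial.X v)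

/-- `φ` is a branch of `P^s` on `U`: `P` has no zero on `U`, `φ` is continuous on `U`, and for each
`x ∈ U` the number `φ x` is one of the values `exp (s w)`, `exp w = P x`, of the multivalued
power `(P x)^s`. -/
def IsPowBranch {E : Type*} [TopologicalSpace E] (U : Set E) (P : E → ℂ) (s : ℂ) (φ : E → ℂ) :
    Prop :=
  ContinuousOn φ U ∧
    ∀ x ∈ U, P x ≠ 0 ∧ ∃ w : ℂ, Complex.exp w = P x ∧ φ x = Complex.exp (s * w)

end

/-! ### Matrices of operators -/

section Operators

variable {V V' : Type*} [AddCommGroup V] [AddCommGroup V']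

/-! Let `P = det X`. Conjugation by `P^s` turns a derivation `d` into the twisted operator `f ↦ d f
+ s f (d P) P⁻¹`, so outside the case `P = 0` the question is what a minor of the twisted operator
matrix does to `1`. With `W = X⁻¹`, the result is `bCoeff` times the corresponding minor of `Wᵀ`
(`opDet_twisted_one`), and Jacobi's identity (`det_subMat_inv`) rewrites that minor as `P⁻¹ ε(I,J)`
times the complementary minor of `X`.

The twisted identity is proved by induction on the size of the minor. Laplace expansion
(`opDet_succ`) leaves one row of operators acting on minors of `W` of size `k`; these assemble into
determinants with `k` rows taken from columns of `W` and a first row taken from a column of the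
identity. The identity is written as `W X = W X^(1) ⋯ X^(ℓ)`. Starting from the right end of the
chain, each operator matrix strips its own factor off that first row, at the cost of a scalar `s + n
(α + 1) - n 0 + k` (`sum_twisted_detConsLin`): `s` comes from differentiating `P^s`, `n (α + 1) - n
0` from the first row through a trace, and `1` from each of the `k` other rows. What survives is a
minor of `W` of size `k + 1`.

`AddRel.rel_cayley` carries the twisted identity to rational fractions, formal powers and functions.
For polynomials, the identity over `ℚ` descends from the fraction field, restricts to `ℤ` and maps
to any commutative ring; the case `P = 0` is settled by rank. -/

theorem injective_cons_perm (k : ℕ) : Function.Injective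
    fun p : Fin (k + 1) × Equiv.Perm (Fin k) =>
      (p.1.cycleRange⁻¹ * Equiv.Perm.decomposeFin.symm (0, p.2) : Equiv.Perm (Fin (k + 1))) := by
  rintro ⟨j, τ⟩ ⟨j', τ'⟩ h
  -- The second factor fixes `0` and the inverse cycle sends `0` to `j`.
  have hj : j = j' := by
    have := congrArg (fun σ : Equiv.Perm (Fin (k + 1)) => σ 0) h
    simpa [Equiv.Perm.inv_def] using this
  subst hj
  have h2 := Equiv.Perm.decomposeFin.symm.injective (mul_left_cancel h)
  simp_all

/-- Every permutation of `Fin (k + 1)` is determined by the image of `0` and a permutation of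
`Fin k`. -/
theorem sum_perm_fin_succ (k : ℕ) (F : Equiv.Perm (Fin (k + 1)) → V) :
    ∑ σ, F σ = ∑ j : Fin (k + 1), ∑ τ : Equiv.Perm (Fin k),
      F (j.cycleRange⁻¹ * Equiv.Perm.decomposeFin.symm (0, τ)) := by
  rw [← Fintype.sum_prod_type']
  refine (Function.Bijective.sum_comp (g := F) ?_).symm
  rw [Fintype.bijective_iff_injective_and_card]
  refine ⟨injective_cons_perm k, ?_⟩
  simp [Fintype.card_perm, Nat.factorial_succ]

theorem opDet_zero (P : Matrix (Fin 0) (Fin 0) (V → V)) (f : V) : opDet P f = f := by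
  simp [opDet]

/-- Laplace expansion along the first row. -/
theorem opDet_succ {k : ℕ} (P : Matrix (Fin (k + 1)) (Fin (k + 1)) (V → V))
    (hP : ∀ j f g, P 0 j (f + g) = P 0 j f + P 0 j g) (f : V) :
    opDet P f = ∑ j : Fin (k + 1), ((-1 : ℤ) ^ (j : ℕ)) •
      P 0 j (opDet (P.submatrix Fin.succ j.succAbove) f) := by
  simp only [opDet]
  rw [sum_perm_fin_succ]
  refine Finset.sum_congr rfl fun j _ => ?_
  -- The operator from row `0` is applied last, so only that row needs to be additive and no
  -- commutation is used.
  let φ : V →+ V := AddMonoidHom.mk' (P 0 j) (hP j)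
  change _ = _ • φ _
  rw [map_sum, Finset.smul_sum]
  refine Finset.sum_congr rfl fun τ _ => ?_
  rw [map_zsmul, smul_smul]
  congr 1
  · simp [Equiv.Perm.decomposeFin.symm_sign]
  · simp [φ, List.ofFn_succ, Equiv.Perm.inv_def]

/-- An additive relation between two groups of functions. -/
structure AddRel (r : V → V' → Prop) : Prop where
  zero : r 0 0
  add : ∀ {f g f' g'}, r f f' → r g g' → r (f + g) (f' + g')
  neg : ∀ {f f'}, r f f' → r (-f) (-f')

namespace AddRel

variable {r : V → V' → Prop}

theorem sum (hr : AddRel r) {ι : Type*} (s : Finset ι) {F : ι → V} {F' : ι → V'}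
    (h : ∀ i, r (F i) (F' i)) : r (∑ i ∈ s, F i) (∑ i ∈ s, F' i) := by
  classical
  induction s using Finset.induction_on with
  | empty => simpa using hr.zero
  | insert a s ha ih => rw [Finset.sum_insert ha, Finset.sum_insert ha]; exact hr.add (h a) ih

theorem sign_smul (hr : AddRel r) {ι : Type*} [DecidableEq ι] [Fintype ι] (σ : Equiv.Perm ι)
    {f : V} {f' : V'} (h : r f f') :
    r ((Equiv.Perm.sign σ : ℤ) • f) ((Equiv.Perm.sign σ : ℤ) • f') := by
  rcases Int.units_eq_one_or (Equiv.Perm.sign σ) with e | e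
  · simpa [e] using h
  · simpa [e] using hr.neg h

/-- The Leibniz formula uses only compositions, signs and sums, all of which an additive relation
respects. -/
theorem rel_opDet (hr : AddRel r) {k : ℕ} {P : Matrix (Fin k) (Fin k) (V → V)}
    {P' : Matrix (Fin k) (Fin k) (V' → V')}
    (hP : ∀ i j f f', r f f' → r (P i j f) (P' i j f')) {f : V} {f' : V'} (h : r f f') :
    r (opDet P f) (opDet P' f') := by
  refine hr.sum _ fun σ => hr.sign_smul σ ?_
  clear hr
  have aux : ∀ (m : ℕ) (g : Fin m → Fin k × Fin k),
      r ((List.ofFn fun i => P (g i).1 (g i).2).foldr (fun D g => D g) f)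
        ((List.ofFn fun i => P' (g i).1 (g i).2).foldr (fun D g => D g) f') := by
    intro m
    induction m with
    | zero => intro g; simpa using h
    | succ m ih =>
      intro g
      simp only [List.ofFn_succ, List.foldr_cons]
      exact hP _ _ _ _ (ih fun i => g i.succ)
  exact aux k fun i => (i, σ i)

theorem rel_opChainProd (hr : AddRel r) (n : ℕ → ℕ) (ℓ : ℕ)
    {D : ∀ α : Fin ℓ, Matrix (Fin (n α)) (Fin (n (α + 1))) (V → V)}
    {D' : ∀ α : Fin ℓ, Matrix (Fin (n α)) (Fin (n (α + 1))) (V' → V')}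
    (hD : ∀ α i j f f', r f f' → r (D α i j f) (D' α i j f')) (i j) {f : V} {f' : V'}
    (h : r f f') : r (opChainProd n ℓ D i j f) (opChainProd n ℓ D' i j f') := by
  induction ℓ generalizing f f' with
  | zero =>
    simp only [opChainProd, opOne, Matrix.of_apply]
    split_ifs
    · exact h
    · exact hr.zero
  | succ ℓ ih =>
    simp only [opChainProd, opMul, Matrix.of_apply]
    exact hr.sum _ fun l => ih (fun α => hD α.castSucc) l (hD (Fin.last ℓ) _ _ _ _ h)

theorem rel_opDet_DProd (hr : AddRel r) {ℓ : ℕ} {n : ℕ → ℕ} (hn : n ℓ = n 0)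
    {d : ChainVar ℓ n → V → V} {d' : ChainVar ℓ n → V' → V'}
    (hd : ∀ v f f', r f f' → r (d v f) (d' v f')) {k : ℕ} (a b : Fin k → Fin (n 0))
    {f : V} {f' : V'} (h : r f f') :
    r (opDet ((DProd hn d).submatrix a b) f)
      (opDet ((DProd hn d').submatrix a b) f') :=
  hr.rel_opDet (fun i j _ _ hg => hr.rel_opChainProd n ℓ
    (D := fun α => Matrix.of fun i j => d ⟨α, i, j⟩)
    (D' := fun α => Matrix.of fun i j => d' ⟨α, i, j⟩)
    (fun α i j f f' hf => hd ⟨α, i, j⟩ f f' hf) (a i) (Fin.cast hn.symm (b j)) hg) h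

end AddRel

theorem opChainProd_add (n : ℕ → ℕ) (ℓ : ℕ)
    {D : ∀ α : Fin ℓ, Matrix (Fin (n α)) (Fin (n (α + 1))) (V → V)}
    (hD : ∀ α i j f g, D α i j (f + g) = D α i j f + D α i j g) (i j) (f g : V) :
    opChainProd n ℓ D i j (f + g) = opChainProd n ℓ D i j f + opChainProd n ℓ D i j g := by
  induction ℓ generalizing f g with
  | zero => simp only [opChainProd, opOne, Matrix.of_apply]; split_ifs <;> simp
  | succ ℓ ih =>
    simp only [opChainProd, opMul, Matrix.of_apply, hD, ih fun α => hD α.castSucc,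
      Finset.sum_add_distrib]

theorem opChainProd_mul {A : Type*} [CommRing A] (n : ℕ → ℕ) (ℓ : ℕ)
    {D : ∀ α : Fin ℓ, Matrix (Fin (n α)) (Fin (n (α + 1))) (A → A)} (c : A)
    (hD : ∀ α i j f, D α i j (c * f) = c * D α i j f) (i j) (f : A) :
    opChainProd n ℓ D i j (c * f) = c * opChainProd n ℓ D i j f := by
  induction ℓ generalizing f with
  | zero => simp only [opChainProd, opOne, Matrix.of_apply]; split_ifs <;> simp
  | succ ℓ ih =>
    simp only [opChainProd, opMul, Matrix.of_apply, hD, ih fun α => hD α.castSucc,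
      Finset.mul_sum]

end Operators

/-! ### Derivations and determinants -/

section Derivations

variable {A : Type*} [CommRing A] (d : Derivation ℤ A A)

theorem derivation_prod {ι : Type*} [DecidableEq ι] (s : Finset ι) (f : ι → A) :
    d (∏ i ∈ s, f i) = ∑ p ∈ s, ∏ i ∈ s, Function.update f p (d (f p)) i := by
  induction s using Finset.induction_on with
  | empty => simp
  | insert a s ha ih =>
    rw [Finset.prod_insert ha, d.leibniz, ih, Finset.sum_insert ha, Finset.prod_insert ha,
      Function.update_self, add_comm]
    simp only [smul_eq_mul, Finset.mul_sum]
    congr 1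
    · rw [mul_comm]
      congr 1
      refine Finset.prod_congr rfl fun i hi => ?_
      rw [Function.update_of_ne]
      rintro rfl; exact ha hi
    · refine Finset.sum_congr rfl fun p hp => ?_
      rw [Finset.prod_insert ha, Function.update_of_ne]
      rintro rfl; exact ha hp

theorem derivation_det {m : Type*} [Fintype m] [DecidableEq m] (M : Matrix m m A) :
    d M.det = ∑ p, (M.updateRow p fun q => d (M p q)).det := by
  -- Transposing indexes each Leibniz product by rows, so that differentiating one factor is
  -- updating one row.
  have hT : ∀ N : Matrix m m A, N.det = ∑ σ : Equiv.Perm m, Equiv.Perm.sign σ • ∏ i, N i (σ i) :=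
    fun N => by rw [← Matrix.det_transpose, Matrix.det_apply]; rfl
  simp only [hT, map_sum]
  rw [Finset.sum_comm]
  refine Finset.sum_congr rfl fun σ _ => ?_
  rw [Units.smul_def, map_zsmul, derivation_prod, Finset.smul_sum]
  refine Finset.sum_congr rfl fun p _ => ?_
  rw [Units.smul_def]
  congr 1
  refine Finset.prod_congr rfl fun i _ => ?_
  by_cases h : i = p
  · subst h; simp
  · rw [Function.update_of_ne h, Matrix.updateRow_ne h]

/-- Jacobi's formula: the cofactors are the entries of the adjugate, which is `M.det • W`. -/
theorem derivation_det_eq_sum {m : Type*} [Fintype m] [DecidableEq m] (M W : Matrix m m A)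
    (h : M * W = 1) :
    d M.det = M.det * ∑ p, ∑ q, W q p * d (M p q) := by
  have hadj : M.adjugate = M.det • W := by
    calc M.adjugate = M.adjugate * (M * W) := by rw [h, mul_one]
      _ = _ := by rw [← mul_assoc, Matrix.adjugate_mul, Matrix.smul_mul, one_mul]
  rw [derivation_det, Finset.mul_sum]
  refine Finset.sum_congr rfl fun p _ => ?_
  rw [← Matrix.cramer_transpose_apply, Matrix.cramer_eq_adjugate_mulVec, Matrix.mulVec,
    ← Matrix.adjugate_transpose, hadj, dotProduct, Finset.mul_sum]
  refine Finset.sum_congr rfl fun q _ => ?_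
  simp [mul_assoc]

/-- Differentiate `M * W = 1` and multiply on the left by `W`. -/
theorem derivation_inv {m : Type*} [Fintype m] [DecidableEq m] (M W : Matrix m m A)
    (h : M * W = 1) :
    W.map d = - (W * M.map d * W) := by
  have h1 : M.map d * W + M * W.map d = 0 := by
    ext i j
    have := congrArg (fun Z : Matrix m m A => d (Z i j)) h
    simp only [Matrix.mul_apply, map_sum, d.leibniz, smul_eq_mul, Matrix.one_apply] at this
    simp only [Matrix.add_apply, Matrix.mul_apply, Matrix.map_apply, Matrix.zero_apply]
    rw [← Finset.sum_add_distrib]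
    calc _ = _ := Finset.sum_congr rfl fun x _ => by ring
      _ = _ := this
      _ = 0 := by split_ifs <;> simp
  have h2 : W * M = 1 := mul_eq_one_comm.mp h
  calc W.map d = W * M * W.map d := by rw [h2, one_mul]
    _ = W * (M.map d * W + M * W.map d) - W * M.map d * W := by noncomm_ring
    _ = _ := by rw [h1]; simp

end Derivations

/-! ### Determinants as linear functions of their first row. -/

section RowExpansion

variable {A : Type*} [CommRing A] {k : ℕ}

/-- The determinant with rows `v, w 0, …, w (k - 1)`, as a linear function of `v`. -/
noncomputable def detConsLin (w : Fin k → Fin (k + 1) → A) : (Fin (k + 1) → A) →ₗ[A] A :=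
  (Matrix.detRowAlternating (n := Fin (k + 1)) (R := A)).toMultilinearMap.toLinearMap
    (Fin.cons 0 w : Fin (k + 1) → Fin (k + 1) → A) 0

theorem det_of_cons (v : Fin (k + 1) → A) (w : Fin k → Fin (k + 1) → A) :
    (Matrix.of (Fin.cons v w : Fin (k + 1) → Fin (k + 1) → A)).det = detConsLin w v := by
  simp only [detConsLin, MultilinearMap.toLinearMap_apply, Fin.update_cons_zero]
  rfl

theorem det_updateRow_cons_zero (v v' : Fin (k + 1) → A) (w : Fin k → Fin (k + 1) → A) :
    ((Matrix.of (Fin.cons v w : Fin (k + 1) → Fin (k + 1) → A)).updateRow 0 v').det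
      = detConsLin w v' := by
  rw [← det_of_cons]
  congr 1
  exact Fin.update_cons_zero (α := fun _ => Fin (k + 1) → A) v w v'

theorem det_updateRow_cons_succ (v x : Fin (k + 1) → A) (w : Fin k → Fin (k + 1) → A)
    (p : Fin k) :
    ((Matrix.of (Fin.cons v w : Fin (k + 1) → Fin (k + 1) → A)).updateRow p.succ x).det
      = detConsLin (Function.update w p x) v := by
  rw [← det_of_cons]
  congr 1
  exact (Fin.cons_update (α := fun _ => Fin (k + 1) → A) v w p x).symm

theorem detConsLin_update_smul (v x : Fin (k + 1) → A) (w : Fin k → Fin (k + 1) → A)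
    (p : Fin k) (c : A) :
    detConsLin (Function.update w p (c • x)) v = c * detConsLin (Function.update w p x) v := by
  rw [← det_updateRow_cons_succ, ← det_updateRow_cons_succ, Matrix.det_updateRow_smul]

/-- The two determinants differ by exchanging row `0` with row `p + 1`. -/
theorem detConsLin_update_swap (v : Fin (k + 1) → A) (w : Fin k → Fin (k + 1) → A) (p : Fin k) :
    detConsLin (Function.update w p v) (w p) = - detConsLin w v := by
  rw [← det_of_cons, ← det_of_cons]
  have h := (Matrix.detRowAlternating (n := Fin (k + 1)) (R := A)).map_swap
    (Fin.cons v w : Fin (k + 1) → Fin (k + 1) → A) (i := 0) (j := p.succ) (Fin.succ_ne_zero p).symm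
  refine Eq.trans (congrArg Matrix.det ?_) h
  ext i j
  refine Fin.cases ?_ (fun i => ?_) i
  · simp [-Fin.cons_update]
  · by_cases hi : i = p
    · subst hi; simp [-Fin.cons_update]
    · have : Equiv.swap 0 p.succ i.succ = i.succ :=
        Equiv.swap_apply_of_ne_of_ne (Fin.succ_ne_zero i) (by simpa using hi)
      simp [-Fin.cons_update, this, Function.update_of_ne hi]

theorem detConsLin_eq_sum (v : Fin (k + 1) → A) (w : Fin k → Fin (k + 1) → A) :
    detConsLin w v = ∑ q : Fin (k + 1),
      (-1) ^ (q : ℕ) * v q * (Matrix.of fun a b => w a (q.succAbove b)).det := by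
  rw [← det_of_cons, Matrix.det_succ_row_zero]
  rfl

end RowExpansion

/-! ### Stripping one factor of the chain. -/

section Step

variable {A : Type*} [CommRing A] {N a b : Type*} [Fintype N] [DecidableEq N] [Fintype a]
  [DecidableEq a] [Fintype b] [DecidableEq b]

/-- One factor of the chain: `X = L B R`, where only `B` depends on the variables `B i j` of the
derivations `δ i j`, acting on `(det X)^s` times a minor of `W = X⁻¹` one of whose columns is
replaced by a column of `W L B`. -/
theorem sum_twisted_detConsLin (L : Matrix N a A) (B : Matrix a b A) (R : Matrix b N A)
    (W : Matrix N N A) (hW : L * B * R * W = 1) (δ : a → b → Derivation ℤ A A)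
    (hL : ∀ i j p q, δ i j (L p q) = 0) (hR : ∀ i j p q, δ i j (R p q) = 0)
    (hB : ∀ i j p q, δ i j (B p q) = if i = p ∧ j = q then 1 else 0)
    (s u : A) (hu : (L * B * R).det * u = 1) {k : ℕ} (c : Fin (k + 1) → N) (ρ : Fin k → N)
    (i : a) :
    ∑ j, (δ i j (detConsLin (fun p q => W (c q) (ρ p)) fun q => (W * L * B) (c q) j)
        + s * detConsLin (fun p q => W (c q) (ρ p)) (fun q => (W * L * B) (c q) j)
          * δ i j (L * B * R).det * u)
      = (s + Fintype.card b - Fintype.card N + k) *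
          detConsLin (fun p q => W (c q) (ρ p)) fun q => (W * L) (c q) i := by
  set X := L * B * R with hX
  have hWX : W * X = 1 := mul_eq_one_comm.mp hW
  have hdLB : ∀ j p q, δ i j ((L * B) p q) = if j = q then L p i else 0 := by
    intro j p q
    rw [Matrix.mul_apply, map_sum]
    simp only [Derivation.leibniz, hL, hB, smul_eq_mul, mul_zero, add_zero]
    by_cases h : j = q
    · simp [h]
    · simp [h]
  have hdX : ∀ j p q, δ i j (X p q) = L p i * R j q := by
    intro j p q
    rw [hX, Matrix.mul_apply, map_sum]
    simp [Derivation.leibniz, hR, hdLB, mul_comm]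
  -- The derivative of `X` is the rank-one product of column `i` of `L` and row `j` of `R`; hence
  -- that of `W` has rank one as well.
  have hdW : ∀ j p q, δ i j (W p q) = -((W * L) p i * (R * W) j q) := by
    intro j p q
    have h := congrFun (congrFun (derivation_inv (δ i j) X W hW) p) q
    have hm : X.map (δ i j) = Matrix.vecMulVec (fun p => L p i) (fun q => R j q) := by
      ext p q; simp [hdX, Matrix.vecMulVec_apply]
    rw [Matrix.map_apply, hm, Matrix.mul_vecMulVec, Matrix.vecMulVec_mul, Matrix.neg_apply,
      Matrix.vecMulVec_apply] at h
    rw [h]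
    rfl
  have hdP : ∀ j, δ i j X.det = X.det * (R * (W * L)) j i := by
    intro j
    rw [derivation_det_eq_sum (δ i j) X W hW]
    congr 1
    simp only [hdX, Matrix.mul_apply, Finset.mul_sum]
    rw [Finset.sum_comm]
    exact Finset.sum_congr rfl fun q _ => Finset.sum_congr rfl fun p _ => by ring
  set w : Fin k → Fin (k + 1) → A := fun p q => W (c q) (ρ p) with hw
  set v : Fin (k + 1) → A := fun q => (W * L) (c q) i with hv
  set m : b → Fin (k + 1) → A := fun j q => (W * L * B) (c q) j with hm
  -- The term `1` comes from differentiating `B`, the other from differentiating `W`. Both are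
  -- multiples of the same row `v`.
  have hdm : ∀ j, (fun q => δ i j (m j q)) = (1 - (R * W * (L * B)) j j) • v := by
    intro j
    funext q
    simp only [hm, Matrix.mul_assoc W L B]
    rw [Matrix.mul_apply, map_sum]
    simp only [Derivation.leibniz, hdLB, hdW, smul_eq_mul, Finset.sum_add_distrib, if_true,
      Pi.smul_apply, hv]
    rw [sub_mul, one_mul, Matrix.mul_apply (M := W) (N := L), sub_eq_add_neg,
      Matrix.mul_apply (M := R * W), Finset.sum_mul, ← Finset.sum_neg_distrib]
    congr 1
    refine Finset.sum_congr rfl fun p _ => ?_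
    rw [← Matrix.mul_apply]
    ring
  have hdw : ∀ j p, (fun q => δ i j (w p q)) = (-(R * W) j (ρ p)) • v := by
    intro j p
    funext q
    simp only [hw, hdW, hv, Pi.smul_apply, smul_eq_mul]
    ring
  have hdet : ∀ j, δ i j (detConsLin w (m j)) = (1 - (R * W * (L * B)) j j) * detConsLin w v
      + ∑ p, (-(R * W) j (ρ p)) * detConsLin (Function.update w p v) (m j) := by
    intro j
    rw [← det_of_cons, derivation_det, Fin.sum_univ_succ]
    congr 1
    · rw [det_updateRow_cons_zero]
      simp only [Matrix.of_apply, Fin.cons_zero]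
      rw [hdm, map_smul, smul_eq_mul]
    · refine Finset.sum_congr rfl fun p _ => ?_
      rw [det_updateRow_cons_succ]
      simp only [Matrix.of_apply, Fin.cons_succ]
      rw [hdw, detConsLin_update_smul]
  -- By cyclicity this is the trace of `X W = 1`, so the first row contributes `card b - card N`.
  have htr : ∑ j, (R * W * (L * B)) j j = (Fintype.card N : A) := by
    change (R * W * (L * B)).trace = _
    rw [Matrix.trace_mul_comm, ← Matrix.mul_assoc, ← hX, hW, Matrix.trace_one]
  -- Since `W L B R W = W`, the sum over `j` puts `w p` in row `0` while `v` stands in row `p`.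
  -- Exchanging them cancels the sign, so each of the `k` lower rows contributes `1`.
  have hmix : ∀ p, ∑ j, (-(R * W) j (ρ p)) * detConsLin (Function.update w p v) (m j)
      = detConsLin w v := by
    intro p
    have : ∑ j, ((R * W) j (ρ p)) • m j = w p := by
      funext q
      simp only [Finset.sum_apply, Pi.smul_apply, smul_eq_mul, hm, hw]
      calc _ = (W * L * B * (R * W)) (c q) (ρ p) := by
            rw [Matrix.mul_apply]; exact Finset.sum_congr rfl fun j _ => mul_comm _ _
        _ = _ := by
            rw [← Matrix.mul_assoc, Matrix.mul_assoc W L B, Matrix.mul_assoc W, ← hX, hWX,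
              Matrix.one_mul]
    simp only [neg_mul, Finset.sum_neg_distrib]
    simp only [← smul_eq_mul, ← map_smul, ← map_sum]
    rw [this, detConsLin_update_swap, neg_neg]
  have hs : ∀ j, s * detConsLin w (m j) * δ i j X.det * u
      = s * ((R * (W * L)) j i * detConsLin w (m j)) := by
    intro j
    rw [hdP]
    linear_combination (s * detConsLin w (m j) * (R * (W * L)) j i) * hu
  -- Here `W L B R W L = W L` restores `v`; this is the contribution `s`.
  have hlog : ∑ j, (R * (W * L)) j i * detConsLin w (m j) = detConsLin w v := by
    have : ∑ j, ((R * (W * L)) j i) • m j = v := by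
      funext q
      simp only [Finset.sum_apply, Pi.smul_apply, smul_eq_mul, hm, hv]
      calc _ = (W * L * B * (R * (W * L))) (c q) i := by
            rw [Matrix.mul_apply]; exact Finset.sum_congr rfl fun j _ => mul_comm _ _
        _ = _ := by
            rw [← Matrix.mul_assoc, Matrix.mul_assoc W L B, Matrix.mul_assoc W, ← hX, hWX,
              Matrix.one_mul]
    simp only [← smul_eq_mul, ← map_smul, ← map_sum]
    rw [this]
  change ∑ j, (δ i j (detConsLin w (m j)) + s * detConsLin w (m j) * δ i j X.det * u)
    = (s + Fintype.card b - Fintype.card N + k) * detConsLin w v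
  simp only [hdet, hs, Finset.sum_add_distrib]
  rw [← Finset.sum_mul, Finset.sum_sub_distrib, htr, Finset.sum_comm, ← Finset.mul_sum, hlog]
  simp only [hmix, Finset.sum_const, Finset.card_univ, Fintype.card_fin, nsmul_eq_mul, mul_one]
  ring

end Step

/-! ### Stripping the whole chain, and the identity for all minors. -/

section Chain

variable {A : Type*} [CommRing A] {n : ℕ → ℕ}

/-- The product of the first `m` matrices of an infinite chain. -/
def initProd (Y : ∀ α : ℕ, Matrix (Fin (n α)) (Fin (n (α + 1))) A) (m : ℕ) :
    Matrix (Fin (n 0)) (Fin (n m)) A :=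
  chainProd n m fun α => Y α

theorem initProd_zero (Y : ∀ α : ℕ, Matrix (Fin (n α)) (Fin (n (α + 1))) A) :
    initProd Y 0 = 1 := rfl

theorem initProd_succ (Y : ∀ α : ℕ, Matrix (Fin (n α)) (Fin (n (α + 1))) A) (m : ℕ) :
    initProd Y (m + 1) = initProd Y m * Y m := rfl

variable {Y : ∀ α : ℕ, Matrix (Fin (n α)) (Fin (n (α + 1))) A} {α : ℕ} (d : Derivation ℤ A A)

theorem derivation_initProd_eq_zero (hd : ∀ β, β ≠ α → ∀ p q, d (Y β p q) = 0) {m : ℕ}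
    (hm : m ≤ α) (p q) : d (initProd Y m p q) = 0 := by
  induction m with
  | zero =>
    rw [initProd_zero, Matrix.one_apply]
    split_ifs <;> simp
  | succ m ih =>
    rw [initProd_succ, Matrix.mul_apply, map_sum]
    refine Finset.sum_eq_zero fun l _ => ?_
    rw [d.leibniz, hd m (by omega), ih (by omega)]
    simp

/-- A single `R` serves every derivation that sees only factor `α`, because it is the product of the
factors after `α`. -/
theorem exists_initProd_eq_mul (Y : ∀ α : ℕ, Matrix (Fin (n α)) (Fin (n (α + 1))) A) {m : ℕ}
    (hm : α + 1 ≤ m) :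
    ∃ R : Matrix (Fin (n (α + 1))) (Fin (n m)) A, initProd Y m = initProd Y (α + 1) * R ∧
      ∀ d : Derivation ℤ A A, (∀ β, β ≠ α → ∀ p q, d (Y β p q) = 0) → ∀ p q, d (R p q) = 0 := by
  induction m, hm using Nat.le_induction with
  | base =>
    refine ⟨1, by rw [Matrix.mul_one], fun d _ p q => ?_⟩
    rw [Matrix.one_apply]
    split_ifs <;> simp
  | succ m hm ih =>
    obtain ⟨R, hR, hd⟩ := ih
    refine ⟨R * Y m, by rw [initProd_succ, hR, Matrix.mul_assoc], fun d h p q => ?_⟩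
    rw [Matrix.mul_apply, map_sum]
    refine Finset.sum_eq_zero fun l _ => ?_
    rw [d.leibniz, hd d h, h m (by omega)]
    simp

/-- The chain of operators `∂^(1) ⋯ ∂^(m)`, conjugated by `(det X)^s`, lowers the last row index of
a minor of `X⁻¹ X^(1) ⋯ X^(m)`. -/
theorem sum_opChainProd_detConsLin {ℓ : ℕ} (hn : n ℓ = n 0)
    (δ : ∀ α, Fin (n α) → Fin (n (α + 1)) → Derivation ℤ A A)
    (hne : ∀ α < ℓ, ∀ β, β ≠ α → ∀ i j p q, δ α i j (Y β p q) = 0)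
    (heq : ∀ α < ℓ, ∀ i j p q, δ α i j (Y α p q) = if i = p ∧ j = q then 1 else 0)
    (X W : Matrix (Fin (n 0)) (Fin (n 0)) A)
    (hX : X = (initProd Y ℓ).submatrix id (Fin.cast hn.symm)) (hW : X * W = 1)
    (s u : A) (hs : ∀ α i j, δ α i j s = 0) (hu : X.det * u = 1) {k : ℕ}
    (c : Fin (k + 1) → Fin (n 0)) (ρ : Fin k → Fin (n 0)) {m : ℕ} (hm : m ≤ ℓ) (i : Fin (n 0)) :
    ∑ l, opChainProd n m
        (fun α => Matrix.of fun i j f => δ α i j f + s * f * δ α i j X.det * u) i l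
        (detConsLin (fun p q => W (c q) (ρ p)) fun q => (W * initProd Y m) (c q) l)
      = (∏ α ∈ Finset.range m, (s + n (α + 1) - n 0 + k)) *
          detConsLin (fun p q => W (c q) (ρ p)) fun q => W (c q) i := by
  induction m with
  | zero =>
    rw [initProd_zero, Matrix.mul_one]
    simp [opChainProd, opOne]
  | succ m ih =>
    obtain ⟨R, hR, hRd⟩ := exists_initProd_eq_mul Y (α := m) hm
    have hdm := hne m hm
    have hfac : X = initProd Y m * Y m * R.submatrix id (Fin.cast hn.symm) := by
      rw [hX, hR, initProd_succ]; rfl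
    have hstep := sum_twisted_detConsLin (initProd Y m) (Y m) (R.submatrix id (Fin.cast hn.symm)) W
      (by rw [← hfac]; exact hW) (δ m)
      (fun i j p q => derivation_initProd_eq_zero (δ m i j)
        (fun β hβ => hne m hm β hβ i j) le_rfl p q)
      (fun i j p q => hRd (δ m i j) (fun β hβ => hne m hm β hβ i j) p _)
      (heq m hm) s u (by rw [← hfac]; exact hu) c ρ
    rw [← hfac] at hstep
    simp only [Fintype.card_fin] at hstep
    set T : ∀ m, ∀ α : Fin m, Matrix (Fin (n α)) (Fin (n (α + 1))) (A → A) := fun m α =>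
      Matrix.of fun i j f => δ α i j f + s * f * δ α i j X.det * u with hT
    have hadd : ∀ i l f g, opChainProd n m (T m) i l (f + g) = opChainProd n m (T m) i l f
        + opChainProd n m (T m) i l g :=
      opChainProd_add n m fun α i j f g => by simp only [hT, Matrix.of_apply, map_add]; ring
    have hdc : ∀ α i j, δ α i j (s + n (m + 1) - n 0 + k) = 0 := by
      intro α i j
      simp [hs]
    -- The scalar produced by the last factor is a constant for all the derivations, so it passes
    -- through the remaining operators.
    have hmul := opChainProd_mul n m (D := T m) (s + n (m + 1) - n 0 + k)
      fun α i j f => by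
        simp only [hT, Matrix.of_apply, Derivation.leibniz, hdc, smul_eq_mul]
        ring
    calc _ = ∑ l, ∑ r, opChainProd n m (T m) i r (δ m r l
            (detConsLin (fun p q => W (c q) (ρ p)) fun q => (W * initProd Y (m + 1)) (c q) l)
          + s * (detConsLin (fun p q => W (c q) (ρ p)) fun q =>
            (W * initProd Y (m + 1)) (c q) l) * δ m r l X.det * u) := rfl
      _ = ∑ r, opChainProd n m (T m) i r (∑ l, (δ m r l
            (detConsLin (fun p q => W (c q) (ρ p)) fun q => (W * initProd Y (m + 1)) (c q) l)
          + s * (detConsLin (fun p q => W (c q) (ρ p)) fun q =>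
            (W * initProd Y (m + 1)) (c q) l) * δ m r l X.det * u)) := by
        rw [Finset.sum_comm]
        exact Finset.sum_congr rfl fun r _ =>
          (map_sum (AddMonoidHom.mk' _ (hadd i r)) _ _).symm
      _ = ∑ r, opChainProd n m (T m) i r ((s + n (m + 1) - n 0 + k) *
            detConsLin (fun p q => W (c q) (ρ p)) fun q => (W * initProd Y m) (c q) r) := by
        refine Finset.sum_congr rfl fun r _ => ?_
        rw [← hstep r, initProd_succ, ← Matrix.mul_assoc]
      _ = _ := by
        simp only [hmul]
        rw [← Finset.mul_sum, ih (by omega), Finset.prod_range_succ]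
        ring

/-- Each stripped factor yields its column dimension `n (α + 1)`, whereas `bCoeff` is written with
row dimensions; closing the chain up makes the two products equal. -/
theorem prod_range_succ_shift {M : Type*} [CommMonoid M] {ℓ : ℕ} (hℓ : 1 ≤ ℓ) (f : ℕ → M)
    (h : f ℓ = f 0) : ∏ α ∈ Finset.range ℓ, f (α + 1) = ∏ α ∈ Finset.range ℓ, f α := by
  obtain ⟨m, rfl⟩ := Nat.exists_eq_succ_of_ne_zero (by omega : ℓ ≠ 0)
  rw [Finset.prod_range_succ, Finset.prod_range_succ', ← h]

theorem bCoeff_succ (ℓ : ℕ) (n : ℕ → ℕ) (k : ℕ) (s : A) :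
    bCoeff ℓ n (k + 1) s =
      bCoeff ℓ n k s * ∏ α ∈ Finset.range ℓ, (s + n α - n 0 + k) := by
  simp only [bCoeff, Finset.prod_range_succ, Finset.prod_mul_distrib]
  rw [Fin.prod_univ_eq_prod_range (fun α => s + (n α : A) - n 0 + k)]

theorem derivation_bCoeff (d : Derivation ℤ A A) (ℓ : ℕ) (n : ℕ → ℕ) (k : ℕ) {s : A}
    (hs : d s = 0) : d (bCoeff ℓ n k s) = 0 := by
  classical
  have hprod : ∀ {ι : Type} (t : Finset ι) (f : ι → A), (∀ i, d (f i) = 0) →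
      d (∏ i ∈ t, f i) = 0 := by
    intro ι t f hf
    induction t using Finset.induction_on with
    | empty => simp
    | insert a t ha ih => rw [Finset.prod_insert ha, d.leibniz, hf, ih]; simp
  exact hprod _ _ fun α => hprod _ _ fun j => by simp [hs]

/-- The Cayley identity for all minors, after conjugation by `(det X)^s`: the operator
`f ↦ d f + s f (d (det X)) (det X)⁻¹` is `f ↦ (det X)^(-s) d (f (det X)^s)`. -/
theorem opDet_twisted_one {ℓ : ℕ} (hℓ : 1 ≤ ℓ) (hn : n ℓ = n 0) (x : ChainVar ℓ n → A)
    (d : ChainVar ℓ n → Derivation ℤ A A) (hd : ∀ v w, d v (x w) = if v = w then 1 else 0)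
    (s u : A) (hs : ∀ v, d v s = 0) (hu : (XProd hn x).det * u = 1)
    (W : Matrix (Fin (n 0)) (Fin (n 0)) A) (hW : XProd hn x * W = 1)
    {k : ℕ} (a c : Fin k → Fin (n 0)) :
    opDet ((DProd hn fun v f => d v f + s * f * d v (XProd hn x).det * u).submatrix a c) 1
      = bCoeff ℓ n k s * (W.transpose.submatrix a c).det := by
  -- Padding by zero matrices gives one family indexed by `ℕ`, on which the length of the initial
  -- product can vary freely.
  set Y : ∀ α : ℕ, Matrix (Fin (n α)) (Fin (n (α + 1))) A := fun α =>
    if h : α < ℓ then Matrix.of fun i j => x ⟨⟨α, h⟩, i, j⟩ else 0 with hY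
  set δ : ∀ α, Fin (n α) → Fin (n (α + 1)) → Derivation ℤ A A := fun α i j =>
    if h : α < ℓ then d ⟨⟨α, h⟩, i, j⟩ else 0 with hδ
  set X := XProd hn x with hX
  have hXY : X = (initProd Y ℓ).submatrix id (Fin.cast hn.symm) := by
    rw [hX, XProd, initProd]
    congr 2
    funext α
    simp [hY]
  have hD : (fun α : Fin ℓ => (Matrix.of fun i j f =>
        δ α i j f + s * f * δ α i j X.det * u : Matrix (Fin (n α)) (Fin (n (α + 1))) (A → A)))
      = fun α => Matrix.of fun i j f => d ⟨α, i, j⟩ f + s * f * d ⟨α, i, j⟩ X.det * u := by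
    funext α
    simp [hδ]
  have key : ∀ {k : ℕ} (c : Fin (k + 1) → Fin (n 0)) (ρ : Fin k → Fin (n 0)) (i),
      ∑ l, DProd hn (fun v f => d v f + s * f * d v X.det * u) i l
        (detConsLin (fun p q => W (c q) (ρ p)) fun q => if c q = l then 1 else 0)
      = (∏ α ∈ Finset.range ℓ, (s + n α - n 0 + k)) *
          detConsLin (fun p q => W (c q) (ρ p)) fun q => W (c q) i := by
    intro k c ρ i
    have h := sum_opChainProd_detConsLin (Y := Y) hn δ
      (by
        intro α hα β hβ i j p q
        by_cases h : β < ℓ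
        · simp only [hY, hδ, hα, h, dif_pos, Matrix.of_apply, hd]
          rw [if_neg]
          intro e
          exact hβ (congrArg (fun v : ChainVar ℓ n => (v.1 : ℕ)) e).symm
        · simp [hY, h])
      (by
        intro α hα i j p q
        simp only [hY, hδ, hα, dif_pos, Matrix.of_apply, hd]
        simp)
      X W hXY hW s u
      (by
        intro α i j
        by_cases h : α < ℓ
        · simp [hδ, h, hs]
        · simp [hδ, h])
      hu c ρ le_rfl i
    rw [prod_range_succ_shift hℓ (fun α => s + (n α : A) - n 0 + k) (by rw [hn])] at h
    rw [← h, hD]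
    refine Fintype.sum_equiv (finCongr hn.symm) _ _ fun l => ?_
    refine congrArg _ (congrArg _ (funext fun q => ?_))
    -- The indicator of `c q = l` is an entry of `W X`, which is the row the full chain of operators
    -- can strip.
    have hWX : W * X = 1 := mul_eq_one_comm.mp hW
    have := congrFun (congrFun hWX (c q)) l
    rw [Matrix.one_apply] at this
    rw [← this, hXY]
    rfl
  have hadd : ∀ i l f g, DProd hn (fun v f => d v f + s * f * d v X.det * u) i l (f + g)
      = DProd hn (fun v f => d v f + s * f * d v X.det * u) i l f
        + DProd hn (fun v f => d v f + s * f * d v X.det * u) i l g := fun i l =>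
    opChainProd_add n ℓ (fun α i j f g => by simp only [Matrix.of_apply, map_add]; ring) i _
  have hmul : ∀ t i l f, (∀ v, d v t = 0) →
      DProd hn (fun v f => d v f + s * f * d v X.det * u) i l (t * f)
      = t * DProd hn (fun v f => d v f + s * f * d v X.det * u) i l f := fun t i l f ht =>
    opChainProd_mul n ℓ t (fun α i j f => by
      simp only [Matrix.of_apply, Derivation.leibniz, ht, smul_eq_mul]; ring) i _ f
  induction k with
  | zero => simp [opDet_zero, bCoeff]
  | succ k ih =>
    set T := DProd hn (fun v f => d v f + s * f * d v X.det * u) with hT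
    have hsub : ∀ q : Fin (k + 1), opDet ((T.submatrix a c).submatrix Fin.succ q.succAbove) 1
        = bCoeff ℓ n k s * (Matrix.of fun p r => W (c (q.succAbove r)) (a p.succ)).det :=
      fun q => ih (fun p => a p.succ) fun r => c (q.succAbove r)
    rw [opDet_succ _ fun j f g => hadd _ _ f g]
    simp only [hsub, Matrix.submatrix_apply]
    have hb : ∀ v, d v (bCoeff ℓ n k s) = 0 := fun v => derivation_bCoeff (d v) ℓ n k (hs v)
    have hmain := key c (fun p => a p.succ) (a 0)
    have hlast : detConsLin (fun p q => W (c q) (a p.succ)) (fun q => W (c q) (a 0))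
        = (W.transpose.submatrix a c).det := by
      rw [← det_of_cons]
      congr 1
      ext p q
      refine Fin.cases ?_ (fun p => ?_) p <;> simp
    rw [hlast] at hmain
    rw [bCoeff_succ, mul_assoc, ← hmain, Finset.mul_sum]
    simp only [hmul _ _ _ _ hb]
    -- Expanding the determinants in `hmain` along their indicator row recovers the Laplace
    -- expansion: for each `q` only `l = c q` survives.
    let Φ : Fin (n 0) → A →+ A := fun l => AddMonoidHom.mk' (T (a 0) l) (hadd (a 0) l)
    have hΦ : ∀ l f, T (a 0) l f = Φ l f := fun _ _ => rfl
    simp only [hΦ, detConsLin_eq_sum, map_sum, Finset.mul_sum]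
    rw [Finset.sum_comm]
    refine Finset.sum_congr rfl fun q _ => ?_
    rw [Finset.sum_eq_single (c q)]
    · have : ∀ m : A, (-1 : A) ^ (q : ℕ) * (if c q = c q then 1 else 0) * m
          = ((-1 : ℤ) ^ (q : ℕ)) • m := by intro m; simp [zsmul_eq_mul]
      rw [this, map_zsmul, mul_smul_comm]
    · intro l _ hl
      rw [if_neg (Ne.symm hl)]
      simp
    · simp

end Chain

/-! ### Signs of shuffles and Jacobi's complementary minors. -/

section ComplementaryMinors

variable {N : ℕ}

/-- The permutation listing first the elements of `I`, then those of its complement, both in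
increasing order. -/
def shufflePerm (I : Finset (Fin N)) {k m : ℕ} (hk : I.card = k) (hm : Iᶜ.card = m)
    (h : k + m = N) : Equiv.Perm (Fin N) :=
  (finSumFinEquiv.trans (finCongr h)).symm.trans (finSumEquivOfFinset hk hm)

/-- Below the `a`-th element of `I`, counting from `0`, lie `a` elements of `I`; all others belong
to the complement. They count the inversions of the shuffle. -/
theorem card_filter_lt_orderEmbOfFin (I : Finset (Fin N)) {k : ℕ} (hk : I.card = k) (a : Fin k) :
    (Iᶜ.filter fun c => ¬ I.orderEmbOfFin hk a < c).card + a = I.orderEmbOfFin hk a := by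
  set e := I.orderEmbOfFin hk
  have h1 : (I.filter fun c => c < e a).card = a := by
    have : (I.filter fun c => c < e a) = (Finset.Iio a).map e.toEmbedding := by
      ext c
      simp only [Finset.mem_filter, Finset.mem_map, Finset.mem_Iio]
      constructor
      · rintro ⟨hc, hlt⟩
        have : c ∈ Set.range e := by rw [Finset.range_orderEmbOfFin]; exact hc
        obtain ⟨b, rfl⟩ := this
        exact ⟨b, e.lt_iff_lt.mp hlt, rfl⟩
      · rintro ⟨b, hb, rfl⟩
        exact ⟨Finset.orderEmbOfFin_mem I hk b, e.lt_iff_lt.mpr hb⟩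
    rw [this, Finset.card_map, Fin.card_Iio]
  have h2 : (Iᶜ.filter fun c => ¬ e a < c) = Iᶜ.filter fun c => c < e a := by
    refine Finset.filter_congr fun c hc => ?_
    rw [not_lt, le_iff_lt_or_eq, or_iff_left]
    rintro rfl
    exact Finset.mem_compl.mp hc (Finset.orderEmbOfFin_mem I hk a)
  have h3 : (Finset.univ.filter fun c => c < e a).card = e a := by
    rw [← Fin.card_Iio (e a)]
    congr 1
    ext c; simp
  rw [h2, ← h3]
  conv_lhs => rw [← h1]
  rw [add_comm, ← Finset.card_union_of_disjoint, ← Finset.filter_union, Finset.union_compl]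
  exact Finset.disjoint_filter_filter disjoint_compl_right

/-- Inversions occur only between the two increasing blocks, and the `a`-th element `i` of `I` is in
`i - a` of them. The factor `(-1) ^ k` appears because `eps` numbers elements from `1`. -/
theorem sign_shufflePerm (I : Finset (Fin N)) {k m : ℕ} (hk : I.card = k) (hm : Iᶜ.card = m)
    (h : k + m = N) : (Equiv.Perm.sign (shufflePerm I hk hm h) : ℤ) = eps I * (-1) ^ k := by
  have hs : (Equiv.Perm.sign (shufflePerm I hk hm h) : ℤ)
      = ∏ i, ∏ j, if i < j then
          (if shufflePerm I hk hm h i < shufflePerm I hk hm h j then (1 : ℤ) else -1) else 1 := by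
    rw [Equiv.Perm.sign_eq_prod_prod_Ioi]
    push_cast
    refine Finset.prod_congr rfl fun i _ => ?_
    rw [← Finset.prod_filter]
    refine Finset.prod_congr (by ext; simp) fun j _ => ?_
    split_ifs <;> simp
  set g := finSumFinEquiv.trans (finCongr h) with hg
  have hgl : ∀ a, shufflePerm I hk hm h (g (Sum.inl a)) = I.orderEmbOfFin hk a := by
    intro a; simp [shufflePerm, ← hg]
  have hgr : ∀ a, shufflePerm I hk hm h (g (Sum.inr a)) = Iᶜ.orderEmbOfFin hm a := by
    intro a; simp [shufflePerm, ← hg]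
  have hll : ∀ a b, g (Sum.inl a) < g (Sum.inl b) ↔ a < b := by
    intro a b; rw [Fin.lt_def, Fin.lt_def]; simp [hg]
  have hlr : ∀ a b, g (Sum.inl a) < g (Sum.inr b) := by
    intro a b; rw [Fin.lt_def]; simp [hg]; omega
  have hrl : ∀ a b, ¬ g (Sum.inr b) < g (Sum.inl a) := fun a b => (hlr a b).le.not_gt
  have hrr : ∀ a b, g (Sum.inr a) < g (Sum.inr b) ↔ a < b := by
    intro a b; rw [Fin.lt_def, Fin.lt_def]; simp [hg]
  rw [hs, ← g.prod_comp]
  simp only [← g.prod_comp (fun j => ite _ _ _), Fintype.prod_sum_type, hgl, hgr, hll, hlr, hrl,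
    hrr, if_true, if_false, OrderEmbedding.lt_iff_lt]
  have hone : ∀ p : Prop, ∀ [Decidable p], (if p then (if p then (1 : ℤ) else -1) else 1) = 1 := by
    intro p _; split_ifs <;> rfl
  simp only [hone, Finset.prod_const_one, one_mul, mul_one]
  have hprod : ∀ a : Fin k, (∏ b : Fin m,
      if I.orderEmbOfFin hk a < Iᶜ.orderEmbOfFin hm b then (1 : ℤ) else -1)
      = (-1) ^ ((I.orderEmbOfFin hk a : ℕ) + a) := by
    intro a
    have : ∏ b : Fin m, (if I.orderEmbOfFin hk a < Iᶜ.orderEmbOfFin hm b then (1 : ℤ) else -1)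
        = ∏ c ∈ Iᶜ, if I.orderEmbOfFin hk a < c then (1 : ℤ) else -1 := by
      conv_rhs => rw [← Finset.map_orderEmbOfFin_univ Iᶜ hm]
      rw [Finset.prod_map]
      rfl
    rw [this, Finset.prod_ite, Finset.prod_const_one, Finset.prod_const, one_mul,
      ← card_filter_lt_orderEmbOfFin I hk a, add_assoc, pow_add _ _ ((a : ℕ) + a),
      Even.neg_one_pow ⟨_, rfl⟩, mul_one]
  simp only [hprod]
  rw [Finset.prod_pow_eq_pow_sum, Finset.sum_add_distrib,
    Fin.sum_univ_eq_sum_range (fun a => a), Finset.sum_range_id, eps, hk]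
  have hI : ∑ a, (I.orderEmbOfFin hk a : ℕ) = ∑ i ∈ I, (i : ℕ) := by
    conv_rhs => rw [← Finset.map_orderEmbOfFin_univ I hk]
    rw [Finset.sum_map]
    rfl
  rw [hI, Finset.sum_add_distrib, Finset.sum_const, hk, smul_eq_mul, mul_one, pow_add, pow_add,
    mul_assoc, mul_assoc, ← pow_add _ k k, Even.neg_one_pow ⟨k, rfl⟩, mul_one, mul_comm]

/-- Jacobi's identity for complementary minors. -/
theorem det_subMat_inv {A : Type*} [CommRing A] (X W : Matrix (Fin N) (Fin N) A) (hW : X * W = 1)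
    {I J : Finset (Fin N)} (h : I.card = J.card) :
    X.det * (subMat W.transpose I J h).det =
      (eps₂ I J : ℤ) * (subMat X Iᶜ Jᶜ (card_compl_eq_of_card_eq h)).det := by
  have hc := card_compl_eq_of_card_eq h
  have hN : I.card + Iᶜ.card = N := by rw [Finset.card_add_card_compl, Fintype.card_fin]
  set e := finSumEquivOfFinset (s := I) rfl rfl with he
  set f := finSumEquivOfFinset (s := J) h.symm hc.symm with hf
  have h1 : X.submatrix e f * W.submatrix f e = 1 := by
    rw [Matrix.submatrix_mul_equiv, hW, Matrix.submatrix_one_equiv]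
  set X' := X.submatrix e f with hX'
  set W' := W.submatrix f e with hW'
  rw [← Matrix.fromBlocks_toBlocks X', ← Matrix.fromBlocks_toBlocks W',
    Matrix.fromBlocks_multiply, ← Matrix.fromBlocks_one, Matrix.fromBlocks_inj] at h1
  -- Keeping only the first block column of the inverse makes both factors' determinants visible:
  -- the right side is block triangular with determinant the complementary minor.
  have h2 : X' * Matrix.fromBlocks W'.toBlocks₁₁ 0 W'.toBlocks₂₁ 1
      = Matrix.fromBlocks 1 X'.toBlocks₁₂ 0 X'.toBlocks₂₂ := by
    conv_lhs => rw [← Matrix.fromBlocks_toBlocks X', Matrix.fromBlocks_multiply]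
    rw [h1.1, h1.2.2.1]
    simp
  have h3 := congrArg Matrix.det h2
  rw [Matrix.det_mul, Matrix.det_fromBlocks_zero₁₂, Matrix.det_fromBlocks_zero₂₁,
    Matrix.det_one, Matrix.det_one, mul_one, one_mul] at h3
  have h4 : X'.toBlocks₂₂ = subMat X Iᶜ Jᶜ hc := by
    ext i j; simp [hX', he, hf, Matrix.toBlocks₂₂, subMat]
  have h5 : W'.toBlocks₁₁ = (subMat W.transpose I J h).transpose := by
    ext i j; simp [hW', he, hf, Matrix.toBlocks₁₁, subMat]
  have h6 : X'.det = (eps₂ I J : ℤ) * X.det := by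
    have : X' = (X.submatrix id (e.symm.trans f)).submatrix e e := by
      ext i j; simp [hX']
    rw [this, Matrix.det_submatrix_equiv_self, Matrix.det_permute']
    -- Both shuffles carry the same factor `(-1) ^ I.card`, which therefore cancels.
    have hσ : e.symm.trans f = shufflePerm J h.symm hc.symm hN * (shufflePerm I rfl rfl hN)⁻¹ := by
      ext i; simp [shufflePerm, he, hf, Equiv.Perm.inv_def]
    congr 2
    rw [hσ, Equiv.Perm.sign_mul, Equiv.Perm.sign_inv, Units.val_mul, sign_shufflePerm,
      sign_shufflePerm, eps₂]
    have : ((-1 : ℤ) ^ I.card) * (-1) ^ I.card = 1 := by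
      rw [← pow_add, Even.neg_one_pow ⟨_, rfl⟩]
    linear_combination eps I * eps J * this
  rw [h4, h5, h6, Matrix.det_transpose] at h3
  have hsq : (eps₂ I J : ℤ) * eps₂ I J = 1 := by
    have : ∀ K : Finset (Fin N), eps K * eps K = 1 := by
      intro K
      rw [eps, ← pow_add, ← pow_add, Even.neg_one_pow ⟨_, rfl⟩]
    rw [eps₂]
    linear_combination (eps I * eps I) * this J + this I
  have hsq' : ((eps₂ I J : ℤ) : A) * (eps₂ I J : ℤ) = 1 := by
    rw [← Int.cast_mul, hsq, Int.cast_one]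
  rw [← h3]
  linear_combination (-X.det * (subMat W.transpose I J h).det) * hsq'

end ComplementaryMinors

/-! ### Transfer from the coefficient ring to other settings. -/

section Transfer

/-- The derivations of a ring. -/
abbrev IntDerivation (A : Type*) [CommRing A] : Type _ := Derivation ℤ A A

theorem IntDerivation.apply_mul {A : Type*} [CommRing A] (d : IntDerivation A) (a b : A) :
    d (a * b) = a * d b + b * d a := d.leibniz a b

/-- A derivation over any base ring, as a derivation over `ℤ`. -/
def intDerivation {R A : Type*} [CommRing R] [CommRing A] [Algebra R A] (d : Derivation R A A) :
    IntDerivation A :=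
  Derivation.mk' (d : A →ₗ[R] A).toAddMonoidHom.toIntLinearMap fun a b => d.leibniz a b

theorem intDerivation_apply {R A : Type*} [CommRing R] [CommRing A] [Algebra R A]
    (d : Derivation R A A) (a : A) : intDerivation d a = d a := rfl

theorem det_inverse_minors {A : Type*} [CommRing A] {N : ℕ} (X : Matrix (Fin N) (Fin N) A) {u : A}
    (hu : X.det * u = 1) :
    ∃ W : Matrix (Fin N) (Fin N) A, X * W = 1 ∧ W.transpose.det = u ∧
      ∀ (I J : Finset (Fin N)) (h : I.card = J.card), (subMat W.transpose I J h).det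
        = u * ((eps₂ I J : ℤ) * (subMat X Iᶜ Jᶜ (card_compl_eq_of_card_eq h)).det) := by
  have hW : X * X⁻¹ = 1 := X.mul_nonsing_inv (IsUnit.of_mul_eq_one u hu)
  refine ⟨X⁻¹, hW, ?_, fun I J h => ?_⟩
  · rw [Matrix.det_transpose]
    have := congrArg Matrix.det hW
    rw [Matrix.det_mul, Matrix.det_one] at this
    linear_combination u * this - (X⁻¹).det * hu
  · rw [← det_subMat_inv X X⁻¹ hW h]
    linear_combination (-(subMat (X⁻¹).transpose I J h).det) * hu

variable {A V : Type*} [CommRing A] [AddCommGroup V] {ℓ : ℕ} {n : ℕ → ℕ}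

/-- The Cayley identity in any group of functions related to a ring of coefficients in which the
operators act as `g ↦ d g + s g (d (det X)) (det X)⁻¹`. -/
theorem AddRel.rel_cayley {r : V → A → Prop} (hr : AddRel r) (hℓ : 1 ≤ ℓ) (hn : n ℓ = n 0)
    (x : ChainVar ℓ n → A) (d : ChainVar ℓ n → Derivation ℤ A A)
    (hd : ∀ v w, d v (x w) = if v = w then 1 else 0)
    (s u : A) (hs : ∀ v, d v s = 0) (hu : (XProd hn x).det * u = 1)
    (D : ChainVar ℓ n → V → V)
    (hD : ∀ v f g, r f g → r (D v f) (d v g + s * g * d v (XProd hn x).det * u))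
    {ψ : V} (hψ : r ψ 1) :
    r (opDet (DProd hn D) ψ) (bCoeff ℓ n (n 0) s * u) ∧
    ∀ (I J : Finset (Fin (n 0))) (h : I.card = J.card),
      r (opDet (subMat (DProd hn D) I J h) ψ) (bCoeff ℓ n I.card s * u *
        ((eps₂ I J : ℤ) * (subMat (XProd hn x) Iᶜ Jᶜ (card_compl_eq_of_card_eq h)).det)) := by
  obtain ⟨W, hW, hW1, hW2⟩ := det_inverse_minors _ hu
  refine ⟨?_, fun I J h => ?_⟩
  · rw [← hW1]
    have := hr.rel_opDet_DProd hn hD id id hψ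
    rw [opDet_twisted_one hℓ hn x d hd s u hs hu W hW] at this
    exact this
  · rw [mul_assoc, ← hW2 I J h]
    have := hr.rel_opDet_DProd hn hD (I.orderEmbOfFin rfl) (J.orderEmbOfFin h.symm) hψ
    rw [opDet_twisted_one hℓ hn x d hd s u hs hu W hW] at this
    exact this

theorem chainProd_map {A B : Type*} [Semiring A] [Semiring B] (f : A →+* B) (n : ℕ → ℕ) (ℓ : ℕ)
    (Y : ∀ α : Fin ℓ, Matrix (Fin (n α)) (Fin (n (α + 1))) A) :
    (chainProd n ℓ Y).map f = chainProd n ℓ fun α => (Y α).map f := by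
  induction ℓ with
  | zero => simp [chainProd]
  | succ ℓ ih =>
    simp only [chainProd]
    rw [Matrix.map_mul, ih]
    rfl

theorem XProd_map {A B : Type*} [Semiring A] [Semiring B] (f : A →+* B) (hn : n ℓ = n 0)
    (x : ChainVar ℓ n → A) : (XProd hn x).map f = XProd hn fun v => f (x v) := by
  rw [XProd, ← Matrix.submatrix_map, chainProd_map]
  rfl

theorem map_det_XProd {A B : Type*} [CommRing A] [CommRing B] (f : A →+* B) (hn : n ℓ = n 0)
    (x : ChainVar ℓ n → A) : f (XProd hn x).det = (XProd hn fun v => f (x v)).det := by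
  rw [RingHom.map_det, RingHom.mapMatrix_apply, XProd_map]

theorem map_det_subMat_XProd {A B : Type*} [CommRing A] [CommRing B] (f : A →+* B)
    (hn : n ℓ = n 0) (x : ChainVar ℓ n → A) (I J : Finset (Fin (n 0))) (h : I.card = J.card) :
    f (subMat (XProd hn x) I J h).det = (subMat (XProd hn fun v => f (x v)) I J h).det := by
  rw [RingHom.map_det, RingHom.mapMatrix_apply, subMat, ← Matrix.submatrix_map, XProd_map]
  rfl

theorem map_bCoeff {A B : Type*} [CommRing A] [CommRing B] (f : A →+* B) (ℓ : ℕ) (n : ℕ → ℕ)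
    (k : ℕ) (s : A) : f (bCoeff ℓ n k s) = bCoeff ℓ n k (f s) := by
  simp [bCoeff]

end Transfer

/-! ### Integer powers in fields of rational fractions. -/

section RationalFractions

variable {ℓ : ℕ} {n : ℕ → ℕ}

/-- The Cayley identity for integer powers in a field with derivations. -/
theorem cayley_field {F : Type*} [Field F] (hℓ : 1 ≤ ℓ) (hn : n ℓ = n 0) (x : ChainVar ℓ n → F)
    (d : ChainVar ℓ n → IntDerivation F) (hd : ∀ v w, d v (x w) = if v = w then 1 else 0)
    (s : ℤ) (hP : (XProd hn x).det ≠ 0) :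
    opDet (DProd hn fun v f => d v f) ((XProd hn x).det ^ s)
        = bCoeff ℓ n (n 0) (s : F) * (XProd hn x).det ^ (s - 1) ∧
    ∀ (I J : Finset (Fin (n 0))) (h : I.card = J.card),
      opDet (subMat (DProd hn fun v f => d v f) I J h) ((XProd hn x).det ^ s)
        = bCoeff ℓ n I.card (s : F) * (XProd hn x).det ^ (s - 1)
          * ((eps₂ I J : ℤ) * (subMat (XProd hn x) Iᶜ Jᶜ (card_compl_eq_of_card_eq h)).det) := by
  set P := (XProd hn x).det with hPdef
  have hr : AddRel fun f g : F => f = g * P ^ s :=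
    ⟨by simp, fun h h' => by rw [h, h', add_mul], fun h => by rw [h, neg_mul]⟩
  have hs1 : P ^ (s - 1) = P⁻¹ * P ^ s := by rw [zpow_sub_one₀ hP, mul_comm]
  have := hr.rel_cayley hℓ hn x d hd (s : F) P⁻¹ (fun v => by simp) (mul_inv_cancel₀ hP)
    (fun v f => d v f)
    (fun v f g h => by
      rw [h, Derivation.leibniz, Derivation.leibniz_zpow, ← hPdef, hs1]
      simp only [smul_eq_mul, zsmul_eq_mul]
      ring)
    (ψ := P ^ s) (one_mul _).symm
  refine ⟨this.1.trans ?_, fun I J h => (this.2 I J h).trans ?_⟩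
  · rw [hs1]; ring
  · rw [hs1]; ring

theorem cayley_ratX (K : Type*) [Field K] (hℓ : 1 ≤ ℓ) (hn : n ℓ = n 0) (s : ℤ)
    (hP : (ratX K hn).det ≠ 0) :
    opDet (DProd hn (ratD K)) ((ratX K hn).det ^ s)
        = bCoeff ℓ n (n 0) (s : FractionRing (MvPolynomial (ChainVar ℓ n) K))
          * (ratX K hn).det ^ (s - 1) ∧
    ∀ (I J : Finset (Fin (n 0))) (h : I.card = J.card),
      opDet (subMat (DProd hn (ratD K)) I J h) ((ratX K hn).det ^ s)
        = bCoeff ℓ n I.card (s : FractionRing (MvPolynomial (ChainVar ℓ n) K))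
          * (ratX K hn).det ^ (s - 1)
          * ((eps₂ I J : ℤ) * (subMat (ratX K hn) Iᶜ Jᶜ (card_compl_eq_of_card_eq h)).det) :=
  cayley_field hℓ hn (fun v => algebraMap (MvPolynomial (ChainVar ℓ n) K) _ (MvPolynomial.X v))
    (fun v => intDerivation (locDeriv (R := K) (nonZeroDivisors (MvPolynomial (ChainVar ℓ n) K))
      (MvPolynomial.pderiv v)))
    (fun v w => by
      rw [intDerivation_apply, locDeriv_algebraMap, MvPolynomial.pderiv_X]
      by_cases h : v = w
      · subst h; simp
      · simp [h]) s hP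

end RationalFractions

/-! ### Symbolic exponent. -/

section SymbolicPower

variable (K : Type*) [Field K] {ℓ : ℕ} {n : ℕ → ℕ}

theorem symPow_coef_smul {σ : Type*} {P : MvPolynomial σ (Polynomial K)} (a : SymRing K P)
    (f : SymPow K P) : (a • f).coef = a * f.coef := rfl

theorem symInv_mul {σ : Type*} (P : MvPolynomial σ (Polynomial K)) :
    algebraMap (MvPolynomial σ (Polynomial K)) (SymRing K P) P * symInv K P = 1 :=
  IsLocalization.Away.mul_invSelf P

theorem det_symX (hn : n ℓ = n 0) :
    (symX K hn).det = algebraMap _ (SymRing K (symP K hn)) (symP K hn) :=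
  (map_det_XProd (algebraMap _ (SymRing K (symP K hn))) hn MvPolynomial.X).symm

/-- The partial derivatives of `K[x, s, P⁻¹]`. -/
noncomputable def symDeriv {σ : Type*} (P : MvPolynomial σ (Polynomial K)) (v : σ) :
    IntDerivation (SymRing K P) :=
  intDerivation (locDeriv (R := Polynomial K) (B := SymRing K P) (Submonoid.powers P) (MvPolynomial.pderiv v))

theorem symDeriv_algebraMap {σ : Type*} (P : MvPolynomial σ (Polynomial K)) (v : σ) (p) :
    symDeriv K P v (algebraMap (MvPolynomial σ (Polynomial K)) (SymRing K P) p) =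
      algebraMap (MvPolynomial σ (Polynomial K)) (SymRing K P) (MvPolynomial.pderiv v p) :=
  locDeriv_algebraMap (R := Polynomial K) (B := SymRing K P) (Submonoid.powers P) (MvPolynomial.pderiv v) p

theorem symDeriv_symS {σ : Type*} (P : MvPolynomial σ (Polynomial K)) (v : σ) :
    symDeriv K P v (symS K P) = 0 := by
  rw [symS, symDeriv_algebraMap, MvPolynomial.pderiv_C, map_zero]

theorem symDeriv_X {σ : Type*} [DecidableEq σ] (P : MvPolynomial σ (Polynomial K)) (v w : σ) :
    symDeriv K P v (algebraMap (MvPolynomial σ (Polynomial K)) (SymRing K P) (MvPolynomial.X w)) = if v = w then 1 else 0 := by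
  rw [symDeriv_algebraMap, MvPolynomial.pderiv_X]
  by_cases h : v = w
  · subst h; simp
  · simp [h]

/-- The Cayley identity in any group of functions on which the operators act as on
`K[x, s, P⁻¹] P^s`. -/
theorem AddRel.rel_cayley_sym {V : Type*} [AddCommGroup V] (hℓ : 1 ≤ ℓ) (hn : n ℓ = n 0)
    {r : V → SymRing K (symP K hn) → Prop} (hr : AddRel r) (D : ChainVar ℓ n → V → V)
    (hD : ∀ v f g, r f g → r (D v f) (symDeriv K (symP K hn) v g + symS K (symP K hn) * g *
      algebraMap _ _ (MvPolynomial.pderiv v (symP K hn)) * symInv K (symP K hn)))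
    {ψ : V} (hψ : r ψ 1) :
    r (opDet (DProd hn D) ψ) (bCoeff ℓ n (n 0) (symS K (symP K hn)) * symInv K (symP K hn)) ∧
    ∀ (I J : Finset (Fin (n 0))) (h : I.card = J.card),
      r (opDet (subMat (DProd hn D) I J h) ψ)
        (bCoeff ℓ n I.card (symS K (symP K hn)) * symInv K (symP K hn) *
        ((eps₂ I J : ℤ) * (subMat (symX K hn) Iᶜ Jᶜ (card_compl_eq_of_card_eq h)).det)) := by
  refine hr.rel_cayley hℓ hn _ (symDeriv K (symP K hn)) (symDeriv_X K _) (symS K (symP K hn))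
    (symInv K (symP K hn)) (symDeriv_symS K _) ?_ D ?_ hψ
  · change (symX K hn).det * _ = 1
    rw [det_symX, symInv_mul]
  · intro v f g h
    change r _ (_ + _ * symDeriv K _ v (symX K hn).det * _)
    rw [det_symX, symDeriv_algebraMap]
    exact hD v f g h

theorem cayley_symPow (hℓ : 1 ≤ ℓ) (hn : n ℓ = n 0) :
    opDet (DProd hn (symD K (symP K hn))) (symPow K (symP K hn))
        = (bCoeff ℓ n (n 0) (symS K (symP K hn)) * symInv K (symP K hn)) •
            symPow K (symP K hn) ∧
    ∀ (I J : Finset (Fin (n 0))) (h : I.card = J.card),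
      opDet (subMat (DProd hn (symD K (symP K hn))) I J h) (symPow K (symP K hn))
        = (bCoeff ℓ n I.card (symS K (symP K hn)) * symInv K (symP K hn)
            * ((eps₂ I J : ℤ)
              * (subMat (symX K hn) Iᶜ Jᶜ (card_compl_eq_of_card_eq h)).det)) •
            symPow K (symP K hn) := by
  have hr : AddRel fun (f : SymPow K (symP K hn)) (g : SymRing K (symP K hn)) =>
      f = g • symPow K (symP K hn) :=
    ⟨by rw [zero_smul], fun h h' => by rw [h, h', add_smul], fun h => by rw [h, neg_smul]⟩
  refine hr.rel_cayley_sym K hℓ hn (symD K (symP K hn)) ?_ (one_smul _ _).symm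
  rintro v f g rfl
  ext
  simp only [symD, symPow_coef_smul, symPow, mul_one]
  rfl

end SymbolicPower

/-! ### Natural powers over commutative rings. -/

section PolynomialRing

variable {ℓ : ℕ} {n : ℕ → ℕ}

/-- The Cayley identity for the natural power `s` in a ring `A` with operators `D v`. -/
def CayleyPow {A : Type*} [CommRing A] (hn : n ℓ = n 0) (x : ChainVar ℓ n → A)
    (D : ChainVar ℓ n → A → A) (s : ℕ) : Prop :=
  opDet (DProd hn D) ((XProd hn x).det ^ s)
      = bCoeff ℓ n (n 0) (s : A) * (XProd hn x).det ^ (s - 1) ∧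
  ∀ (I J : Finset (Fin (n 0))) (h : I.card = J.card),
    opDet (subMat (DProd hn D) I J h) ((XProd hn x).det ^ s)
      = bCoeff ℓ n I.card (s : A) * (XProd hn x).det ^ (s - 1)
        * ((eps₂ I J : ℤ) * (subMat (XProd hn x) Iᶜ Jᶜ (card_compl_eq_of_card_eq h)).det)

section Map

variable {A B : Type*} [CommRing A] [CommRing B] (φ : A →+* B) {hn : n ℓ = n 0}
  {x : ChainVar ℓ n → A} {D : ChainVar ℓ n → A → A} {D' : ChainVar ℓ n → B → B} {s : ℕ}

theorem map_opDet_DProd (hn : n ℓ = n 0) (hD : ∀ v f, φ (D v f) = D' v (φ f)) {k : ℕ}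
    (a b : Fin k → Fin (n 0)) (f : A) :
    φ (opDet ((DProd hn D).submatrix a b) f) = opDet ((DProd hn D').submatrix a b) (φ f) :=
  AddRel.rel_opDet_DProd (r := fun f g => φ f = g)
    ⟨map_zero φ, fun h h' => by rw [map_add, h, h'], fun h => by rw [map_neg, h]⟩ hn
    (fun v f f' h => by rw [hD, h]) a b rfl

/-- Used to descend along injections: from rational fractions to polynomials, and from `ℚ` to `ℤ`.
-/
theorem CayleyPow.map_iff (hφ : ∀ a b, φ a = φ b ↔ a = b) (hD : ∀ v f, φ (D v f) = D' v (φ f)) :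
    CayleyPow hn (fun v => φ (x v)) D' s ↔ CayleyPow hn x D s := by
  have h1 := map_opDet_DProd φ hn hD id id ((XProd hn x).det ^ s)
  have h2 : ∀ (I J : Finset (Fin (n 0))) (h : I.card = J.card),
      φ (opDet (subMat (DProd hn D) I J h) ((XProd hn x).det ^ s))
        = opDet (subMat (DProd hn D') I J h) (φ ((XProd hn x).det ^ s)) :=
    fun I J h => map_opDet_DProd φ hn hD _ _ _
  simp only [Matrix.submatrix_id_id] at h1
  simp only [CayleyPow, ← map_det_XProd, ← map_det_subMat_XProd, ← map_natCast φ, ← map_bCoeff,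
    ← map_intCast φ, ← map_mul, ← map_pow, ← h1, ← h2, hφ]

theorem CayleyPow.map (hD : ∀ v f, φ (D v f) = D' v (φ f)) (h : CayleyPow hn x D s) :
    CayleyPow hn (fun v => φ (x v)) D' s := by
  have h1 := map_opDet_DProd φ hn hD id id ((XProd hn x).det ^ s)
  have h2 : ∀ (I J : Finset (Fin (n 0))) (h : I.card = J.card),
      φ (opDet (subMat (DProd hn D) I J h) ((XProd hn x).det ^ s))
        = opDet (subMat (DProd hn D') I J h) (φ ((XProd hn x).det ^ s)) :=
    fun I J h => map_opDet_DProd φ hn hD _ _ _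
  simp only [Matrix.submatrix_id_id] at h1
  simp only [CayleyPow, ← map_det_XProd, ← map_det_subMat_XProd, ← map_natCast φ, ← map_bCoeff,
    ← map_intCast φ, ← map_mul, ← map_pow, ← h1, ← h2]
  exact ⟨congrArg φ h.1, fun I J hIJ => congrArg φ (h.2 I J hIJ)⟩

end Map

/-- A product of matrices with an inner dimension smaller than `k` has no nonzero minor of
size `k`. -/
theorem det_submatrix_mul_eq_zero {F : Type*} [Field F] {N M k : ℕ} (L : Matrix (Fin N) (Fin M) F)
    (R : Matrix (Fin M) (Fin N) F) (hk : M < k) (a b : Fin k → Fin N) :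
    ((L * R).submatrix a b).det = 0 := by
  by_contra h
  have hu : IsUnit ((L * R).submatrix a b) :=
    (Matrix.isUnit_iff_isUnit_det _).mpr (isUnit_iff_ne_zero.mpr h)
  have h1 := Matrix.rank_of_isUnit _ hu
  have h2 : (L * R).submatrix a b = L.submatrix a id * R.submatrix id b := by
    ext i j; simp [Matrix.mul_apply]
  have h3 := Matrix.rank_mul_le_left (L.submatrix a id) (R.submatrix id b)
  have h4 := Matrix.rank_le_width (L.submatrix a id)
  rw [← h2, h1, Fintype.card_fin] at h3
  omega

theorem exists_chainProd_eq_mul {A : Type*} [CommRing A] (m : ℕ)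
    (Y : ∀ α : Fin m, Matrix (Fin (n α)) (Fin (n (α + 1))) A) (α : ℕ) (hα : α ≤ m) :
    ∃ (L : Matrix (Fin (n 0)) (Fin (n α)) A) (R : Matrix (Fin (n α)) (Fin (n m)) A),
      chainProd n m Y = L * R := by
  induction m with
  | zero =>
    obtain rfl : α = 0 := by omega
    exact ⟨1, 1, by simp [chainProd]⟩
  | succ m ih =>
    rcases Nat.lt_or_ge m α with h | h
    · obtain rfl : α = m + 1 := by omega
      exact ⟨_, 1, (Matrix.mul_one _).symm⟩
    · obtain ⟨L, R, hLR⟩ := ih (fun β => Y β.castSucc) h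
      exact ⟨L, _, by rw [chainProd, hLR, Matrix.mul_assoc]⟩

theorem det_submatrix_XProd_eq_zero {F : Type*} [Field F] (hn : n ℓ = n 0)
    (x : ChainVar ℓ n → F) {α : ℕ} (hα : α ≤ ℓ) {k : ℕ} (hk : n α < k)
    (a b : Fin k → Fin (n 0)) : ((XProd hn x).submatrix a b).det = 0 := by
  obtain ⟨L, R, hLR⟩ := exists_chainProd_eq_mul ℓ
    (fun α => Matrix.of fun i j => x ⟨α, i, j⟩) α hα
  have : XProd hn x = L * R.submatrix id (Fin.cast hn.symm) := by
    rw [XProd, hLR]; rfl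
  rw [this]
  exact det_submatrix_mul_eq_zero _ _ hk a b

/-- Rectangular identity matrices lose none of the first `n 0` coordinates when no dimension drops
below `n 0`. They supply a point where `det X = 1`. -/
theorem chainProd_diagonal (A : Type*) [CommRing A] (m : ℕ) (h : ∀ α ≤ m, n 0 ≤ n α) (i j) :
    chainProd n m (fun α => Matrix.of fun (i : Fin (n α)) (j : Fin (n (α + 1))) =>
      if (i : ℕ) = j then (1 : A) else 0) i j = if (i : ℕ) = j then 1 else 0 := by
  induction m with
  | zero => simp [chainProd, Matrix.one_apply, Fin.ext_iff]
  | succ m ih =>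
    have ih := ih fun α hα => h α (by omega)
    simp only [chainProd, Matrix.mul_apply, Fin.val_castSucc, Fin.val_last, Matrix.of_apply]
    rw [Finset.sum_eq_single (⟨i, i.2.trans_le (h m (by omega))⟩ : Fin (n m))]
    · have := ih ⟨i, i.2.trans_le (h m (by omega))⟩
      erw [this]
      simp
    · intro b _ hb
      erw [ih b]
      rw [if_neg, zero_mul]
      intro e
      exact hb (Fin.ext e.symm)
    · simp

theorem det_polyX_ne_zero (R : Type*) [CommRing R] [Nontrivial R] (hn : n ℓ = n 0)
    (h : ∀ α < ℓ, n 0 ≤ n α) : (polyX R hn).det ≠ 0 := by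
  intro h0
  have h1 := congrArg (MvPolynomial.eval fun v : ChainVar ℓ n =>
    if (v.2.1 : ℕ) = v.2.2 then (1 : R) else 0) h0
  rw [polyX, map_det_XProd, map_zero] at h1
  simp only [MvPolynomial.eval_X] at h1
  have h2 : (XProd hn fun v : ChainVar ℓ n => if (v.2.1 : ℕ) = v.2.2 then (1 : R) else 0) = 1 := by
    ext i j
    rw [XProd, Matrix.submatrix_apply]
    refine (chainProd_diagonal R ℓ (fun α hα => ?_) _ _).trans ?_
    · rcases hα.lt_or_eq with hlt | rfl
      · exact h α hlt
      · exact hn.ge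
    · simp [Matrix.one_apply, Fin.ext_iff]
  rw [h2, Matrix.det_one] at h1
  exact one_ne_zero h1

theorem bCoeff_one_eq_zero {A : Type*} [CommRing A] {α k : ℕ} (hα : α < ℓ) (h0 : n α < n 0)
    (hk : n 0 ≤ n α + k) : bCoeff ℓ n k (1 : A) = 0 := by
  refine Finset.prod_eq_zero (Finset.mem_univ (⟨α, hα⟩ : Fin ℓ)) ?_
  -- The index solving `1 + n α - n 0 + j = 0`.
  refine Finset.prod_eq_zero (i := n 0 - n α - 1) (Finset.mem_range.mpr (by omega)) ?_
  rw [Nat.sub_sub, Nat.cast_sub (by omega)]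
  push_cast
  ring

theorem opDet_subMat_DProd_zero {V : Type*} [AddCommGroup V] (hn : n ℓ = n 0)
    {D : ChainVar ℓ n → V → V} (hD : ∀ v, D v 0 = 0) {k : ℕ} (a b : Fin k → Fin (n 0)) :
    opDet ((DProd hn D).submatrix a b) 0 = 0 :=
  (AddRel.rel_opDet_DProd (r := fun f g : V => f = 0 ∧ g = 0) (d' := D)
    ⟨⟨rfl, rfl⟩, fun h h' => by simp [h, h'], fun h => by simp [h]⟩ hn
    (fun v f f' h => by simp [h, hD]) a b ⟨rfl, rfl⟩).1

theorem cayleyPow_ratD (K : Type*) [Field K] (hℓ : 1 ≤ ℓ) (hn : n ℓ = n 0) {s : ℕ} (hs : 1 ≤ s) :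
    CayleyPow hn (fun v => algebraMap (MvPolynomial (ChainVar ℓ n) K)
      (FractionRing (MvPolynomial (ChainVar ℓ n) K)) (MvPolynomial.X v)) (ratD K) s := by
  by_cases hP : (ratX K hn).det = 0
  -- If `det X = 0`, some inner dimension is too small. The left sides vanish because `s ≥ 1`; for
  -- `s ≥ 2` so does `P^(s-1)`.
  · obtain ⟨α, hα, hlt⟩ : ∃ α < ℓ, n α < n 0 := by
      by_contra! hcon
      refine det_polyX_ne_zero K hn hcon ?_
      apply IsFractionRing.injective (MvPolynomial (ChainVar ℓ n) K)
        (FractionRing (MvPolynomial (ChainVar ℓ n) K))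
      rw [map_zero, ← hP, polyX, map_det_XProd]
      rfl
    have hz : ∀ v, ratD K v (0 : FractionRing (MvPolynomial (ChainVar ℓ n) K)) = 0 :=
      fun v => map_zero (locDeriv (R := K) _ (MvPolynomial.pderiv v))
    change (XProd hn _).det = 0 at hP
    rw [CayleyPow, hP, zero_pow (by omega)]
    have hfull := opDet_subMat_DProd_zero hn hz id id
    rw [Matrix.submatrix_id_id] at hfull
    refine ⟨hfull.trans ?_, fun I J h => (opDet_subMat_DProd_zero hn hz _ _).trans ?_⟩
    · rcases hs.eq_or_lt with rfl | hs
      · rw [Nat.cast_one, bCoeff_one_eq_zero hα hlt (by omega), zero_mul]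
      · rw [zero_pow (by omega), mul_zero]
    · rcases hs.eq_or_lt with rfl | hs
      -- For `s = 1` the power is `0 ^ 0 = 1`: either the complementary minor is larger than the
      -- rank allows, or a factor of `bCoeff` is zero.
      · rcases Nat.lt_or_ge (n α + I.card) (n 0) with hk | hk
        · rw [subMat, det_submatrix_XProd_eq_zero hn _ hα.le, mul_zero, mul_zero]
          rw [Finset.card_compl, Fintype.card_fin]
          omega
        · rw [Nat.cast_one, bCoeff_one_eq_zero hα hlt hk, zero_mul, zero_mul]
      · rw [zero_pow (by omega), mul_zero, zero_mul]
  · have := cayley_ratX K hℓ hn (s : ℤ) hP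
    have hs1 : (s : ℤ) - 1 = ((s - 1 : ℕ) : ℤ) := by omega
    simp only [hs1, zpow_natCast, Int.cast_natCast] at this
    exact this

theorem algebraMap_polyD (K : Type*) [Field K] {σ : Type*} (v : σ) (f : MvPolynomial σ K) :
    algebraMap _ (FractionRing (MvPolynomial σ K)) (polyD K v f)
      = ratD K v (algebraMap _ (FractionRing (MvPolynomial σ K)) f) :=
  (locDeriv_algebraMap (R := K) (B := FractionRing (MvPolynomial σ K)) _
    (MvPolynomial.pderiv v) f).symm

theorem cayleyPow_polyD_field (K : Type*) [Field K] (hℓ : 1 ≤ ℓ) (hn : n ℓ = n 0) {s : ℕ}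
    (hs : 1 ≤ s) : CayleyPow hn (MvPolynomial.X (R := K)) (polyD K) s := by
  have h1 := cayleyPow_ratD K hℓ hn hs
  have hinj := IsFractionRing.injective (MvPolynomial (ChainVar ℓ n) K)
    (FractionRing (MvPolynomial (ChainVar ℓ n) K))
  rwa [CayleyPow.map_iff (D := polyD K) (algebraMap (MvPolynomial (ChainVar ℓ n) K)
    (FractionRing (MvPolynomial (ChainVar ℓ n) K))) (fun a b => hinj.eq_iff)
    (algebraMap_polyD K)] at h1

theorem map_polyD {R S : Type*} [CommRing R] [CommRing S] (φ : R →+* S) {σ : Type*} (v : σ)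
    (f : MvPolynomial σ R) :
    MvPolynomial.map φ (polyD R v f) = polyD S v (MvPolynomial.map φ f) :=
  MvPolynomial.pderiv_map.symm

theorem cayleyPow_polyD (R : Type*) [CommRing R] (hℓ : 1 ≤ ℓ) (hn : n ℓ = n 0) {s : ℕ}
    (hs : 1 ≤ s) : CayleyPow hn (MvPolynomial.X (R := R)) (polyD R) s := by
  have hQ := cayleyPow_polyD_field ℚ hℓ hn hs
  have hinj := MvPolynomial.map_injective (σ := ChainVar ℓ n) (Int.castRingHom ℚ)
    (RingHom.injective_int _)
  rw [← funext fun v : ChainVar ℓ n => MvPolynomial.map_X (Int.castRingHom ℚ) v,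
    CayleyPow.map_iff (D := polyD ℤ) (MvPolynomial.map (Int.castRingHom ℚ))
    (fun a b => hinj.eq_iff) (map_polyD _)] at hQ
  have hR := hQ.map (MvPolynomial.map (Int.castRingHom R)) (map_polyD _)
  rwa [funext fun v : ChainVar ℓ n => MvPolynomial.map_X (Int.castRingHom R) v] at hR

end PolynomialRing

/-! ### Differentiability of continuous branches of a power. -/

section Branches

open Complex Filter Topology

/-- A continuous branch of `p^s` along a line is differentiable, with the expected logarithmic
derivative. -/
theorem hasDerivAt_of_powBranch {𝕜 : Type*} [RCLike 𝕜] [NormedAlgebra 𝕜 ℂ] {p ψ : 𝕜 → ℂ} {p' s : ℂ}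
    (hp : HasDerivAt p p' 0) (hpc : Continuous p) (hψ : ∀ᶠ t in 𝓝 0, ContinuousAt ψ t)
    (hb : ∀ᶠ t in 𝓝 (0 : 𝕜), p t ≠ 0 ∧ ∃ w : ℂ, exp w = p t ∧ ψ t = exp (s * w)) :
    HasDerivAt ψ (s * ψ 0 * (p' / p 0)) 0 := by
  obtain ⟨hp0, w₀, hw₀, hψ₀⟩ := hb.self_of_nhds
  -- A logarithm of `p` near `0` that takes the prescribed value `w₀` there; the quotient stays near
  -- `1`, away from the cut.
  set L : 𝕜 → ℂ := fun t => w₀ + log (p t / p 0) with hL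
  have hslit : ∀ᶠ t in 𝓝 (0 : 𝕜), p t / p 0 ∈ slitPlane := by
    have hc : ContinuousAt (fun t => p t / p 0) 0 := (hpc.div_const _).continuousAt
    refine hc.eventually_mem (isOpen_slitPlane.mem_nhds ?_)
    rw [div_self hp0]
    exact one_mem_slitPlane
  have hL0 : L 0 = w₀ := by simp [hL, div_self hp0]
  have hexpL : ∀ t, p t ≠ 0 → exp (L t) = p t := by
    intro t ht
    rw [hL, exp_add, hw₀, exp_log (div_ne_zero ht hp0)]
    field_simp
  obtain ⟨r, hr, hball⟩ := Metric.eventually_nhds_iff_ball.mp (hslit.and (hψ.and hb))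
  have hconst : ∀ t ∈ Metric.ball (0 : 𝕜) r, ψ t / exp (s * L t) = 1 := by
    set q : 𝕜 → ℂ := fun t => ψ t / exp (s * L t) with hq
    have hqc : ContinuousOn q (Metric.ball 0 r) := by
      intro t ht
      obtain ⟨h1, h2, -⟩ := hball t ht
      have hLt : ContinuousAt L t :=
        continuousAt_const.add ((hpc.div_const _).continuousAt.clog h1)
      exact (h2.div (continuousAt_const.mul hLt).cexp (exp_ne_zero _)).continuousWithinAt
    -- Two logarithms differ by a multiple of `2πi`, so the continuous ratio takes countably many
    -- values on a connected ball and is constant.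
    have hsub : q '' Metric.ball 0 r ⊆ Set.range fun m : ℤ => exp (s * (m * (2 * Real.pi * I))) := by
      rintro _ ⟨t, ht, rfl⟩
      obtain ⟨-, -, h3, w, hw, hψw⟩ := hball t ht
      obtain ⟨m, hm⟩ := exp_eq_exp_iff_exists_int.mp (hw.trans (hexpL t h3).symm)
      refine ⟨m, ?_⟩
      simp only [hq]
      rw [hψw, hm, ← exp_sub]
      congr 1
      ring
    have hpre : IsPreconnected (q '' Metric.ball 0 r) :=
      (convex_ball (0 : 𝕜) r).isPreconnected.image q hqc
    have hss := ((Set.countable_range _).mono hsub).isTotallyDisconnected _ subset_rfl hpre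
    intro t ht
    have h0 : q 0 = 1 := by
      simp only [hq]
      rw [hψ₀, hL0, div_self (exp_ne_zero _)]
    rw [← h0]
    exact hss ⟨t, ht, rfl⟩ ⟨0, Metric.mem_ball_self hr, rfl⟩
  have heq : ψ =ᶠ[𝓝 0] fun t => exp (s * L t) := by
    filter_upwards [Metric.ball_mem_nhds (0 : 𝕜) hr] with t ht
    exact (div_eq_one_iff_eq (exp_ne_zero _)).mp (hconst t ht)
  have hLd : HasDerivAt L (p' / p 0) 0 := by
    have h1 : HasDerivAt (fun t => p t / p 0) (p' / p 0) 0 := hp.div_const _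
    have h2 : HasDerivAt Complex.log 1 (p 0 / p 0) := by
      rw [div_self hp0]
      simpa using Complex.hasDerivAt_log one_mem_slitPlane
    refine ((h2.scomp_of_eq (0 : 𝕜) h1 rfl).const_add w₀).congr_deriv ?_
    rw [smul_eq_mul, mul_one]
  have h4 : HasDerivAt (fun t => exp (s * L t)) (s * ψ 0 * (p' / p 0)) 0 := by
    have h5 : HasDerivAt (fun t => s * L t) (s * (p' / p 0)) 0 := hLd.const_mul s
    have h6 := (Complex.hasDerivAt_exp (s * L 0)).scomp_of_eq (0 : 𝕜) h5 rfl
    rw [hψ₀]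
    refine h6.congr_deriv ?_
    rw [hL0, smul_eq_mul]
    ring
  exact h4.congr_of_eventuallyEq heq

end Branches

/-! ### Functions of real or complex variables, by evaluating the symbolic ring. -/

section FunctionsOnOpenSets

open Complex Filter Topology

variable {𝕜 : Type*} [RCLike 𝕜] [NormedAlgebra 𝕜 ℂ] {σ : Type*}

/-- The value at `x` and at the exponent `s` of a polynomial over `ℂ[s]`. -/
noncomputable def polyEvalAt (s : ℂ) (x : σ → 𝕜) : MvPolynomial σ (Polynomial ℂ) →+* ℂ :=
  MvPolynomial.eval₂Hom (Polynomial.evalRingHom s) fun v => algebraMap 𝕜 ℂ (x v)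

theorem polyEvalAt_X (s : ℂ) (x : σ → 𝕜) (v : σ) :
    polyEvalAt s x (MvPolynomial.X v) = algebraMap 𝕜 ℂ (x v) := by
  simp [polyEvalAt]

theorem hasDerivAt_polyEvalAt [DecidableEq σ] (s : ℂ) (x : σ → 𝕜) (v : σ)
    (p : MvPolynomial σ (Polynomial ℂ)) (t₀ : 𝕜) :
    HasDerivAt (fun t : 𝕜 => polyEvalAt s (x + t • (Pi.single v 1 : σ → 𝕜)) p)
      (polyEvalAt s (x + t₀ • (Pi.single v 1 : σ → 𝕜)) (MvPolynomial.pderiv v p)) t₀ := by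
  induction p using MvPolynomial.induction_on with
  | C a =>
    simp only [polyEvalAt, MvPolynomial.coe_eval₂Hom, MvPolynomial.eval₂_C, MvPolynomial.pderiv_C,
      MvPolynomial.eval₂_zero]
    exact hasDerivAt_const _ _
  | add p q hp hq =>
    simp only [map_add]
    exact hp.add hq
  | mul_X p w hp =>
    simp only [map_mul, polyEvalAt_X, Derivation.leibniz, map_add, smul_eq_mul,
      MvPolynomial.pderiv_X]
    have h1 : HasDerivAt (fun t : 𝕜 => algebraMap 𝕜 ℂ ((x + t • (Pi.single v 1 : σ → 𝕜)) w))
        (algebraMap 𝕜 ℂ ((Pi.single v 1 : σ → 𝕜) w)) t₀ := by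
      have h2 : HasDerivAt (fun t : 𝕜 => (x + t • (Pi.single v 1 : σ → 𝕜)) w)
          ((Pi.single v 1 : σ → 𝕜) w) t₀ := by
        simp only [Pi.add_apply, Pi.smul_apply, smul_eq_mul]
        simpa using ((hasDerivAt_id t₀).mul_const ((Pi.single v 1 : σ → 𝕜) w)).const_add (x w)
      exact (algebraMapCLM 𝕜 ℂ).hasFDerivAt.comp_hasDerivAt t₀ h2
    refine (hp.mul h1).congr_deriv ?_
    have h3 : polyEvalAt s (x + t₀ • (Pi.single v 1 : σ → 𝕜))
        ((Pi.single v 1 : σ → MvPolynomial σ (Polynomial ℂ)) w)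
        = algebraMap 𝕜 ℂ ((Pi.single v 1 : σ → 𝕜) w) := by
      by_cases h : w = v
      · subst h; simp
      · simp [Pi.single_eq_of_ne h]
    rw [h3]
    ring

/-- The value at a point `x` with `P x ≠ 0` and at the exponent `s` of an element of
`ℂ[x, s, P⁻¹]`. -/
noncomputable def symEvalAt {P : MvPolynomial σ (Polynomial ℂ)} (s : ℂ) (x : σ → 𝕜)
    (hx : polyEvalAt s x P ≠ 0) : SymRing ℂ P →+* ℂ :=
  IsLocalization.Away.lift P (isUnit_iff_ne_zero.mpr hx)

theorem symEvalAt_algebraMap {P : MvPolynomial σ (Polynomial ℂ)} (s : ℂ) (x : σ → 𝕜)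
    (hx : polyEvalAt s x P ≠ 0) (p) :
    symEvalAt s x hx (algebraMap _ _ p) = polyEvalAt s x p :=
  IsLocalization.Away.lift_eq P _ p

theorem symEvalAt_symS {P : MvPolynomial σ (Polynomial ℂ)} (s : ℂ) (x : σ → 𝕜)
    (hx : polyEvalAt s x P ≠ 0) : symEvalAt s x hx (symS ℂ P) = s := by
  rw [symS, symEvalAt_algebraMap]
  simp [polyEvalAt]

theorem symEvalAt_symInv {P : MvPolynomial σ (Polynomial ℂ)} (s : ℂ) (x : σ → 𝕜)
    (hx : polyEvalAt s x P ≠ 0) : symEvalAt s x hx (symInv ℂ P) = (polyEvalAt s x P)⁻¹ := by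
  have h := congrArg (symEvalAt s x hx) (symInv_mul ℂ P)
  rw [map_mul, map_one, symEvalAt_algebraMap] at h
  exact eq_inv_of_mul_eq_one_right h

theorem hasDerivAt_symEvalAt [DecidableEq σ] {P : MvPolynomial σ (Polynomial ℂ)} (s : ℂ)
    (x : σ → 𝕜) (hx : polyEvalAt s x P ≠ 0) (v : σ) (g : SymRing ℂ P) (F : 𝕜 → ℂ)
    (hF : ∀ᶠ t in 𝓝 (0 : 𝕜), ∃ h : polyEvalAt s (x + t • (Pi.single v 1 : σ → 𝕜)) P ≠ 0,
      F t = symEvalAt s _ h g) :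
    HasDerivAt F (symEvalAt s x hx (symDeriv ℂ P v g)) 0 := by
  obtain ⟨⟨p, ⟨q, k, rfl⟩⟩, hg⟩ := IsLocalization.surj (Submonoid.powers P) g
  simp only at hg
  set q := (fun x => P ^ x) k with hq
  have hq0 : ∀ y : σ → 𝕜, polyEvalAt s y P ≠ 0 → polyEvalAt s y q ≠ 0 := by
    intro y hy
    simp only [hq, map_pow]
    exact pow_ne_zero _ hy
  -- Differentiating `g q = p` determines the derivative of `g`, to be compared with the analytic
  -- quotient rule.
  have hd := congrArg (symDeriv ℂ P v) hg
  rw [IntDerivation.apply_mul, symDeriv_algebraMap, symDeriv_algebraMap] at hd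
  have hd' := congrArg (symEvalAt s x hx) hd
  simp only [map_add, map_mul, symEvalAt_algebraMap] at hd'
  have hg' := congrArg (symEvalAt s x hx) hg
  rw [map_mul, symEvalAt_algebraMap, symEvalAt_algebraMap] at hg'
  have hdiv := (hasDerivAt_polyEvalAt s x v p 0).div (hasDerivAt_polyEvalAt s x v q 0)
    (by rw [zero_smul, add_zero]; exact hq0 x hx)
  have heq : F =ᶠ[𝓝 0] (fun t : 𝕜 => polyEvalAt s (x + t • (Pi.single v 1 : σ → 𝕜)) p)
      / fun t : 𝕜 => polyEvalAt s (x + t • (Pi.single v 1 : σ → 𝕜)) q := by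
    filter_upwards [hF] with t ht
    obtain ⟨h, hFt⟩ := ht
    have := congrArg (symEvalAt s _ h) hg
    rw [map_mul, symEvalAt_algebraMap, symEvalAt_algebraMap] at this
    rw [hFt, Pi.div_apply]
    exact eq_div_of_mul_eq (hq0 _ h) this
  refine (hdiv.congr_of_eventuallyEq heq).congr_deriv ?_
  rw [zero_smul, add_zero, ← hd', ← hg']
  have := hq0 x hx
  field_simp
  ring

variable {ℓ : ℕ} {n : ℕ → ℕ}

theorem polyEvalAt_symP (hn : n ℓ = n 0) (s : ℂ) (x : ChainVar ℓ n → 𝕜) :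
    polyEvalAt s x (symP ℂ hn) = algebraMap 𝕜 ℂ (XProd hn x).det := by
  rw [symP, polyX, map_det_XProd, map_det_XProd]
  simp only [polyEvalAt_X]

theorem cayley_fun (hℓ : 1 ≤ ℓ) (hn : n ℓ = n 0) (s : ℂ) (U : Set (ChainVar ℓ n → 𝕜))
    (φ : (ChainVar ℓ n → 𝕜) → ℂ) (hU : IsOpen U)
    (hφ : IsPowBranch U (fun x => algebraMap 𝕜 ℂ (XProd hn x).det) s φ) (x) (hx : x ∈ U) :
    opDet (DProd hn (funD 𝕜)) φ x
      = bCoeff ℓ n (n 0) s * (φ x / algebraMap 𝕜 ℂ (XProd hn x).det) ∧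
    ∀ (I J : Finset (Fin (n 0))) (h : I.card = J.card),
      opDet (subMat (DProd hn (funD 𝕜)) I J h) φ x
        = bCoeff ℓ n I.card s * (φ x / algebraMap 𝕜 ℂ (XProd hn x).det)
            * ((eps₂ I J : ℤ) * algebraMap 𝕜 ℂ
              (subMat (XProd hn x) Iᶜ Jᶜ (card_compl_eq_of_card_eq h)).det) := by
  classical
  obtain ⟨hφc, hφU⟩ := hφ
  have hne : ∀ y ∈ U, polyEvalAt s y (symP ℂ hn) ≠ 0 := fun y hy => by
    rw [polyEvalAt_symP]; exact (hφU y hy).1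
  -- Functions are constrained only on `U`; openness makes this enough to compute derivatives at
  -- points of `U`.
  have hr : AddRel fun (f : (ChainVar ℓ n → 𝕜) → ℂ) (g : SymRing ℂ (symP ℂ hn)) =>
      ∀ y (hy : y ∈ U), f y = symEvalAt s y (hne y hy) g * φ y :=
    ⟨fun y hy => by simp, fun h h' y hy => by simp [h y hy, h' y hy, add_mul],
      fun h y hy => by simp [h y hy]⟩
  have hline : ∀ y ∈ U, ∀ v, ∀ᶠ t in 𝓝 (0 : 𝕜), y + t • (Pi.single v 1 : ChainVar ℓ n → 𝕜) ∈ U := by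
    intro y hy v
    have hc : Continuous fun t : 𝕜 => y + t • (Pi.single v 1 : ChainVar ℓ n → 𝕜) := by fun_prop
    exact hc.continuousAt.eventually_mem (hU.mem_nhds (by simpa using hy))
  have hφd : ∀ y (hy : y ∈ U) v,
      HasDerivAt (fun t : 𝕜 => φ (y + t • (Pi.single v 1 : ChainVar ℓ n → 𝕜)))
        (s * φ y * (polyEvalAt s y (MvPolynomial.pderiv v (symP ℂ hn))
          / polyEvalAt s y (symP ℂ hn))) 0 := by
    intro y hy v
    have hc : Continuous fun t : 𝕜 => y + t • (Pi.single v 1 : ChainVar ℓ n → 𝕜) := by fun_prop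
    have hp := hasDerivAt_polyEvalAt s y v (symP ℂ hn)
    have := hasDerivAt_of_powBranch (s := s)
      (ψ := fun t : 𝕜 => φ (y + t • (Pi.single v 1 : ChainVar ℓ n → 𝕜))) (hp 0)
      (continuous_iff_continuousAt.mpr fun t => (hp t).continuousAt)
      (by
        filter_upwards [hline y hy v] with t ht
        exact ContinuousAt.comp (f := fun t : 𝕜 => y + t • (Pi.single v 1 : ChainVar ℓ n → 𝕜))
          (hφc.continuousAt (hU.mem_nhds ht)) hc.continuousAt)
      (by
        filter_upwards [hline y hy v] with t ht
        rw [polyEvalAt_symP]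
        exact hφU _ ht)
    simpa using this
  have main := hr.rel_cayley_sym ℂ hℓ hn (funD 𝕜)
    (by
      intro v f g h y hy
      have h1 := hasDerivAt_symEvalAt s y (hne y hy) v g
        -- Evaluation requires `P ≠ 0`; the default `0` off `U` is irrelevant, as the line stays in
        -- `U` for small `t`.
        (fun t => if h : y + t • (Pi.single v 1 : ChainVar ℓ n → 𝕜) ∈ U then
          symEvalAt s _ (hne _ h) g else 0)
        (by
          filter_upwards [hline y hy v] with t ht
          exact ⟨hne _ ht, dif_pos ht⟩)
      have h2 := h1.mul (hφd y hy v)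
      have h3 : deriv (fun t : 𝕜 => f (y + t • (Pi.single v 1 : ChainVar ℓ n → 𝕜))) 0 = _ :=
        (h2.congr_of_eventuallyEq (by
          filter_upwards [hline y hy v] with t ht
          rw [Pi.mul_apply, dif_pos ht, h _ ht])).deriv
      rw [funD, lineDeriv, h3, map_add, map_mul, map_mul, map_mul, symEvalAt_symS,
        symEvalAt_symInv, symEvalAt_algebraMap]
      have hy0 : y + (0 : 𝕜) • (Pi.single v 1 : ChainVar ℓ n → 𝕜) = y := by simp
      simp only [hy0, hy, dif_pos]
      ring)
    (ψ := φ) (fun y hy => by simp)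
  have hX : ∀ (I J : Finset (Fin (n 0))) (h : I.card = J.card),
      symEvalAt s x (hne x hx) (subMat (symX ℂ hn) I J h).det
        = algebraMap 𝕜 ℂ (subMat (XProd hn x) I J h).det := by
    intro I J h
    rw [symX, map_det_subMat_XProd, map_det_subMat_XProd]
    simp only [symEvalAt_algebraMap, polyEvalAt_X]
  refine ⟨(main.1 x hx).trans ?_, fun I J h => (main.2 I J h x hx).trans ?_⟩
  · rw [map_mul, map_bCoeff, symEvalAt_symS, symEvalAt_symInv, polyEvalAt_symP]
    ring
  · simp only [map_mul, map_bCoeff, symEvalAt_symS, symEvalAt_symInv, polyEvalAt_symP, hX,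
      map_intCast]
    ring

end FunctionsOnOpenSets

theorem theorem2p9 (ℓ : ℕ) (hℓ : 1 ≤ ℓ) (n : ℕ → ℕ) (hn : n ℓ = n 0) :
    -- (1) integers `s ≥ 1`, polynomials over a commutative ring
    (∀ (R : Type*) [CommRing R] (s : ℕ), 1 ≤ s →
      opDet (DProd hn (polyD R)) ((polyX R hn).det ^ s)
          = bCoeff ℓ n (n 0) (s : MvPolynomial (ChainVar ℓ n) R) * (polyX R hn).det ^ (s - 1) ∧
      ∀ (I J : Finset (Fin (n 0))) (h : I.card = J.card),
        opDet (subMat (DProd hn (polyD R)) I J h) ((polyX R hn).det ^ s)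
          = bCoeff ℓ n I.card (s : MvPolynomial (ChainVar ℓ n) R) * (polyX R hn).det ^ (s - 1)
            * ((eps₂ I J : ℤ) * (subMat (polyX R hn) Iᶜ Jᶜ (card_compl_eq_of_card_eq h)).det)) ∧
    -- (2) all integers `s`, rational fractions over a field
    (∀ (K : Type*) [Field K] (s : ℤ), (ratX K hn).det ≠ 0 →
      opDet (DProd hn (ratD K)) ((ratX K hn).det ^ s)
          = bCoeff ℓ n (n 0) (s : FractionRing (MvPolynomial (ChainVar ℓ n) K))
            * (ratX K hn).det ^ (s - 1) ∧
      ∀ (I J : Finset (Fin (n 0))) (h : I.card = J.card),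
        opDet (subMat (DProd hn (ratD K)) I J h) ((ratX K hn).det ^ s)
          = bCoeff ℓ n I.card (s : FractionRing (MvPolynomial (ChainVar ℓ n) K))
            * (ratX K hn).det ^ (s - 1)
            * ((eps₂ I J : ℤ) * (subMat (ratX K hn) Iᶜ Jᶜ (card_compl_eq_of_card_eq h)).det)) ∧
    -- (3) symbolic `s`, in the module `K[x, s, P⁻¹] P^s`; here `P^(s-1)` is `P⁻¹ P^s`
    (∀ (K : Type*) [Field K] [CharZero K], symP K hn ≠ 0 →
      opDet (DProd hn (symD K (symP K hn))) (symPow K (symP K hn))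
          = (bCoeff ℓ n (n 0) (symS K (symP K hn)) * symInv K (symP K hn)) •
              symPow K (symP K hn) ∧
      ∀ (I J : Finset (Fin (n 0))) (h : I.card = J.card),
        opDet (subMat (DProd hn (symD K (symP K hn))) I J h) (symPow K (symP K hn))
          = (bCoeff ℓ n I.card (symS K (symP K hn)) * symInv K (symP K hn)
              * ((eps₂ I J : ℤ)
                * (subMat (symX K hn) Iᶜ Jᶜ (card_compl_eq_of_card_eq h)).det)) •
              symPow K (symP K hn)) ∧
    -- (4) functions of real variables, on any open set with any branch `φ` of `det(X)^s`;
    -- the corresponding branch of `det(X)^(s-1)` is `φ / det(X)`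
    (∀ (s : ℂ) (U : Set (ChainVar ℓ n → ℝ)) (φ : (ChainVar ℓ n → ℝ) → ℂ), IsOpen U →
      IsPowBranch U (fun x => (((XProd hn x).det : ℝ) : ℂ)) s φ → ∀ x ∈ U,
      opDet (DProd hn (funD ℝ)) φ x
          = bCoeff ℓ n (n 0) s * (φ x / (((XProd hn x).det : ℝ) : ℂ)) ∧
      ∀ (I J : Finset (Fin (n 0))) (h : I.card = J.card),
        opDet (subMat (DProd hn (funD ℝ)) I J h) φ x
          = bCoeff ℓ n I.card s * (φ x / (((XProd hn x).det : ℝ) : ℂ))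
              * ((eps₂ I J : ℤ) *
                (((subMat (XProd hn x) Iᶜ Jᶜ (card_compl_eq_of_card_eq h)).det : ℝ) : ℂ))) ∧
    -- (5) the same for functions of complex variables
    (∀ (s : ℂ) (U : Set (ChainVar ℓ n → ℂ)) (φ : (ChainVar ℓ n → ℂ) → ℂ), IsOpen U →
      IsPowBranch U (fun x => (XProd hn x).det) s φ → ∀ x ∈ U,
      opDet (DProd hn (funD ℂ)) φ x = bCoeff ℓ n (n 0) s * (φ x / (XProd hn x).det) ∧
      ∀ (I J : Finset (Fin (n 0))) (h : I.card = J.card),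
        opDet (subMat (DProd hn (funD ℂ)) I J h) φ x
          = bCoeff ℓ n I.card s * (φ x / (XProd hn x).det)
              * ((eps₂ I J : ℤ) *
                (subMat (XProd hn x) Iᶜ Jᶜ (card_compl_eq_of_card_eq h)).det)) := by
  refine ⟨fun R _ s hs => cayleyPow_polyD R hℓ hn hs, fun K _ s hP => cayley_ratX K hℓ hn s hP,
    fun K _ _ _ => cayley_symPow K hℓ hn, fun s U φ hU hφ x hx => ?_, fun s U φ hU hφ x hx => ?_⟩
  · exact cayley_fun (𝕜 := ℝ) hℓ hn s U φ hU hφ x hx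
  · exact cayley_fun (𝕜 := ℂ) hℓ hn s U φ hU hφ x hx
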